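/- **Setting.** All germs are germs at $0\in\mathbb C$. Let $\mathcal M$ be the set of analytic germs $f(z)=z+z^2+z^3+o(z^3)$ (the prenormalized germs of the formal class of $f_0(z)=\frac{z}{1-z}$). For $f\in\mathcal M$ the *analytic class* $[f]_0$ is the set of all $\varphi^{-1}\circ f\circ\varphi$ with $\varphi\in z+z^2\mathbb C\{z\}$. An *attracting petal* $V_+$ of $f$ is a domain with $f(V_+)\subseteq V_+$, all of whose orbits tend to $0$, which does not meet $[0,\infty)$ and contains, for every $\theta<\pi$, a small sector at $0$ of opening $2\theta$ bisected by the negative real axis; a *repelling petal* $V_-$ of $f$ is defined in the same way for $f^{-1}$ and the opposite direction. Consider * an analytic solution $\Psi_+$ on $V_+$ of the Abel equation $\Psi(f(z))-\Psi(z)=1$ such that $\Psi_+(z)+\frac1z$ has a $1$-Gevrey asymptotic expansion in $\mathbb C[[z]]$ as $z\to0$ on $V_+$; * analytic solutions $H_\pm$ on $V_\pm$ of the $1$-Abel equation $H(f(z))-H(z)=-z$ such that $R_\pm(z)=H_\pm(z)+\log_\pm z$ has a $1$-Gevrey asymptotic expansion in $\mathbb C[[z]]$ as $z\to0$ on $V_\pm$,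 where $\arg z\in(0,2\pi)$ on $V_+$ and $\arg z\in(-\pi,\pi)$ on $V_-$. Asymptotic expansions on a petal are meant uniformly on small sectors of each opening less than $2\pi$ bisected by the petal's direction. The *$1$-moment* of $f$ is the pair $(g_\infty,g_0)$ of analytic germs at $0$, with $g_\infty(0)+g_0(0)=0$, such that $$R_+(z)-R_-(z)=g_\infty\big(e^{2\pi i\Psi_+(z)}\big)\ \text{ on } V_+\cap V_-\cap\{\operatorname{Im}z>0\},\qquad R_-(z)-R_+(z)=g_0\big(e^{-2\pi i\Psi_+(z)}\big)\ \text{ on } V_+\cap V_-\cap\{\operatorname{Im}z<0\}$$ (whenever the argument of $g_\infty$, resp. $g_0$, is small), where $(g_\infty^1,g_0^1)$ and $(g_\infty^2,g_0^2)$ are identified if there are $a\in\mathbb C$, $b\in\mathbb C^*$ with $g^1_\infty(t)=g^2_\infty(bt)+a$ and $g^1_0(t)=g^2_0(t/b)-a$ for $t$ near $0$. Two germs $f,g\in\mathcal M$ are *$1$-conjugate* if they have the same $1$-moments, that is, if the sets of identification classes of pairs $(g_\infty,g_0)$ arising from all choices of $V_\pm,\Psi_+,H_\pm$ agree; $[f]_1$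 is the $1$-conjugacy class of $f$, and $\Phi(f)=[f]_1$. **Proposition (Non-injectivity).** Let $f,g\in\mathcal M$ lie in the same analytic class, with $g=\varphi^{-1}\circ f\circ\varphi$ for some $\varphi\in z+z^2\mathbb C\{z\}$. If $$\varphi^{-1}=\mathrm{Id}+r\circ f-r$$ for some analytic germ $r\in\mathbb C\{z\}$, then $f$ and $g$ have the same $1$-moments. Consequently, for every $f\in\mathcal M$, the restriction of $\Phi$ to the analytic class $[f]_0$ is not injective. -/

import Mathlib

open Filter Topology


/-- An analytic germ (represented by a function) in `z + z² ℂ{z}`. -/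
def IsTangentToId (φ : ℂ → ℂ) : Prop :=
  AnalyticAt ℂ φ 0 ∧ φ 0 = 0 ∧ deriv φ 0 = 1

/-- `k` represents the compositional inverse of the germ `f` at `0`. -/
def IsInverseGerm (f k : ℂ → ℂ) : Prop :=
  AnalyticAt ℂ k 0 ∧ k 0 = 0 ∧ ∀ᶠ z in 𝓝 (0 : ℂ), k (f z) = z ∧ f (k z) = z

/-- `f` represents a prenormalized germ of the model formal class (the formal class of
`z / (1 - z)`): it is analytic at `0` and `f(z) = z + z² + z³ + o(z³)`. -/
def IsModelGerm (f : ℂ → ℂ) : Prop :=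
  AnalyticAt ℂ f 0 ∧
    (fun z : ℂ => f z - (z + z ^ 2 + z ^ 3)) =o[𝓝 0] (fun z : ℂ => z ^ 3)

/-- The set of prenormalized germs of the model formal class. -/
def ModelGerm : Type :=
  {F : Germ (𝓝 (0 : ℂ)) ℂ // ∃ f : ℂ → ℂ, IsModelGerm f ∧ F = (f : Germ (𝓝 (0 : ℂ)) ℂ)}

/-- The germ at `0` of a function `f`. -/
noncomputable def ModelGerm.mk (f : ℂ → ℂ) (hf : IsModelGerm f) : ModelGerm :=
  ⟨(f : Germ (𝓝 (0 : ℂ)) ℂ), f, hf, rfl⟩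

/-- `g = φ⁻¹ ∘ f ∘ φ` as germs at `0`, where `φ` is a change of variables tangent to the
identity and `ψ = φ⁻¹`. -/
def ConjugatesBy (φ ψ f g : ℂ → ℂ) : Prop :=
  IsTangentToId φ ∧ IsInverseGerm φ ψ ∧ ∀ᶠ z in 𝓝 (0 : ℂ), g z = ψ (f (φ z))

/-- The analytic class `[F]₀`. -/
def analyticClass (F : ModelGerm) : Set ModelGerm :=
  {G | ∃ f g φ ψ : ℂ → ℂ, F.1 = (f : Germ (𝓝 (0 : ℂ)) ℂ) ∧ G.1 = (g : Germ (𝓝 (0 : ℂ)) ℂ) ∧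
    ConjugatesBy φ ψ f g}

/-- The open sector with vertex `0`, radius `ρ`, bisected by the direction `d`, of opening `2θ`. -/
def sector (d : ℂ) (θ ρ : ℝ) : Set ℂ :=
  {z | z ≠ 0 ∧ ‖z‖ < ρ ∧ |(z / d).arg| < θ}

/-- `V` is a petal in the direction `d` attracted to `0` by `F`: a domain mapped into itself by
`F`, on which the iterates of `F` tend to `0`, and which is bisected at `0` by `d` and tangent at
`0`, from both sides, to the ray opposite to `d` (it contains small sectors around `d` of every
opening less than `2π`, and does not meet the opposite ray). -/
structure IsPetal (d : ℂ) (F : ℂ → ℂ) (V : Set ℂ) : Prop where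
  isOpen : IsOpen V
  isConnected : IsConnected V
  differentiableOn : DifferentiableOn ℂ F V
  mapsTo : Set.MapsTo F V V
  tendsto : ∀ z ∈ V, Tendsto (fun n : ℕ => F^[n] z) atTop (𝓝 0)
  sector_subset : ∀ θ : ℝ, 0 < θ → θ < Real.pi → ∃ ρ : ℝ, 0 < ρ ∧ sector d θ ρ ⊆ V
  subset_slit : ∀ z ∈ V, z / d ∈ Complex.slitPlane

/-- `H` is an analytic solution on `V` of the cohomological equation
`H(f(z)) - H(z) = c(z)`. -/
def IsCohomologicalSolution (f : ℂ → ℂ) (V : Set ℂ) (c H : ℂ → ℂ) : Prop :=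
  DifferentiableOn ℂ H V ∧ ∀ z ∈ V, f z ∈ V → H (f z) - H z = c z

/-- `R` admits a `1`-Gevrey asymptotic expansion in `ℂ⟦z⟧`, as `z → 0`, on a petal in the
direction `d`, that is, uniformly on each small sector around `d` of opening less than `2π`. -/
def HasGevreyExpansion (d : ℂ) (R : ℂ → ℂ) : Prop :=
  ∃ a : ℕ → ℂ, ∀ θ : ℝ, 0 < θ → θ < Real.pi →
    ∃ ρ C A : ℝ, 0 < ρ ∧ 0 < C ∧ 0 < A ∧ ∀ z ∈ sector d θ ρ, ∀ N : ℕ,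
      ‖R z - ∑ n ∈ Finset.range N, a n * z ^ n‖ ≤ C * A ^ N * (N.factorial : ℝ) * ‖z‖ ^ N

/-- The branch of the logarithm on the attracting petal (argument in `(0, 2π)`); on the repelling
petal the branch is `Complex.log`. The two agree in the upper half-plane. -/
noncomputable def logPlus (z : ℂ) : ℂ := Complex.log (-z) + Real.pi * Complex.I

/-- Representatives `(g_∞, g_0)` of pairs of analytic germs at `0` with `g_∞(0) + g_0(0) = 0`. -/
def MomentPair : Type :=
  {p : (ℂ → ℂ) × (ℂ → ℂ) // AnalyticAt ℂ p.1 0 ∧ AnalyticAt ℂ p.2 0 ∧ p.1 0 + p.2 0 = 0}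

/-- The identification of pairs of germs:
`g_∞¹(t) = g_∞²(bt) + a`, `g_0¹(t) = g_0²(t/b) - a` near `t = 0`, for some `a`, `b` with
`b ≠ 0`. -/
def MomentPair.Identified (p q : MomentPair) : Prop :=
  ∃ a b : ℂ, b ≠ 0 ∧ ∀ᶠ t in 𝓝 (0 : ℂ),
    p.1.1 t = q.1.1 (b * t) + a ∧ p.1.2 t = q.1.2 (t / b) - a

theorem MomentPair.identified_equivalence : Equivalence MomentPair.Identified where
  refl p := ⟨0, 1, one_ne_zero, by simp⟩
  symm := by
    rintro p q ⟨a, b, hb, h⟩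
    refine ⟨-a, b⁻¹, inv_ne_zero hb, ?_⟩
    have h1 : Tendsto (fun t : ℂ => b⁻¹ * t) (𝓝 0) (𝓝 0) := by
      have : Continuous (fun t : ℂ => b⁻¹ * t) := by fun_prop
      simpa using this.tendsto 0
    have h2 : Tendsto (fun t : ℂ => b * t) (𝓝 0) (𝓝 0) := by
      have : Continuous (fun t : ℂ => b * t) := by fun_prop
      simpa using this.tendsto 0
    filter_upwards [h1.eventually h, h2.eventually h] with t ht1 ht2
    have e1 : b * (b⁻¹ * t) = t := by field_simp
    have e2 : b * t / b = t := by field_simp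
    have e3 : t / b⁻¹ = b * t := by field_simp
    rw [e1] at ht1
    rw [e2] at ht2
    rw [e3]
    exact ⟨by rw [ht1.1]; ring, by rw [ht2.2]; ring⟩
  trans := by
    rintro p q s ⟨a, b, hb, h⟩ ⟨a', b', hb', h'⟩
    refine ⟨a' + a, b' * b, mul_ne_zero hb' hb, ?_⟩
    have h1 : Tendsto (fun t : ℂ => b * t) (𝓝 0) (𝓝 0) := by
      have : Continuous (fun t : ℂ => b * t) := by fun_prop
      simpa using this.tendsto 0
    have h2 : Tendsto (fun t : ℂ => t / b) (𝓝 0) (𝓝 0) := by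
      have : Continuous (fun t : ℂ => t / b) := by fun_prop
      simpa using this.tendsto 0
    filter_upwards [h, h1.eventually h', h2.eventually h'] with t ht ht1 ht2
    have e1 : b' * (b * t) = b' * b * t := by ring
    have e2 : t / b / b' = t / (b' * b) := by field_simp
    rw [e1] at ht1
    rw [e2] at ht2
    exact ⟨by rw [ht.1, ht1.1]; ring, by rw [ht.2, ht2.2]; ring⟩

/-- The set of pairs of germs with the identifications is the quotient by this relation. -/
def momentSetoid : Setoid MomentPair := ⟨MomentPair.Identified, MomentPair.identified_equivalence⟩

/-- `(g_∞, g_0)` is a `1`-moment of `f` with respect to some choice of petals `V₊`, `V₋`, of a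
trivialization `Ψ₊` of the attracting petal, and of sectorial solutions `H₊`, `H₋` of the
`1`-Abel equation `H(f(z)) - H(z) = -z`. Here `R± = H± + log` are the sectorial solutions freed
from the branches of the logarithm. -/
def IsOneMoment (f : ℂ → ℂ) (p : MomentPair) : Prop :=
  ∃ (k : ℂ → ℂ) (Vp Vm : Set ℂ) (Ψ Hp Hm : ℂ → ℂ),
    IsInverseGerm f k ∧ IsPetal (-1) f Vp ∧ IsPetal 1 k Vm ∧
    IsCohomologicalSolution f Vp (fun _ => 1) Ψ ∧
    HasGevreyExpansion (-1) (fun z => Ψ z + 1 / z) ∧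
    IsCohomologicalSolution f Vp (fun z => -z) Hp ∧
    HasGevreyExpansion (-1) (fun z => Hp z + logPlus z) ∧
    IsCohomologicalSolution f Vm (fun z => -z) Hm ∧
    HasGevreyExpansion 1 (fun z => Hm z + Complex.log z) ∧
    ∃ δ : ℝ, 0 < δ ∧
      (∀ z ∈ Vp ∩ Vm, 0 < z.im →
        ‖Complex.exp (2 * Real.pi * Complex.I * Ψ z)‖ < δ →
        (Hp z + logPlus z) - (Hm z + Complex.log z)
          = p.1.1 (Complex.exp (2 * Real.pi * Complex.I * Ψ z))) ∧
      (∀ z ∈ Vp ∩ Vm, z.im < 0 →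
        ‖Complex.exp (-(2 * Real.pi * Complex.I * Ψ z))‖ < δ →
        (Hm z + Complex.log z) - (Hp z + logPlus z)
          = p.1.2 (Complex.exp (-(2 * Real.pi * Complex.I * Ψ z))))

/-- The `1`-moment of a germ, up to the identifications (the set of all its values, which consists
of a single class). -/
def oneMoment (F : ModelGerm) : Set (Quotient momentSetoid) :=
  {c | ∃ (f : ℂ → ℂ) (p : MomentPair), F.1 = (f : Germ (𝓝 (0 : ℂ)) ℂ) ∧ IsOneMoment f p ∧
    c = Quotient.mk momentSetoid p}

/-- `1`-conjugacy: the two germs have the same `1`-moments. -/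
def OneConjugate (F G : ModelGerm) : Prop := oneMoment F = oneMoment G

/-- The map `Φ(F) = [F]₁`, where `[F]₁` is the `1`-conjugacy class of `F`. -/
def Phi (F : ModelGerm) : Set ModelGerm := {G | OneConjugate G F}

/-! Put `s = r ∘ φ`. Since `φ ∘ g = f ∘ φ`, evaluating `φ⁻¹ = Id + r ∘ f - r` at `φ z` gives `z = φ
z + s (g z) - s z`: the right-hand side `-φ` obtained by composing the `1`-Abel equation of `f` with
`φ` differs from `-z` by a coboundary of `g`. So `Ψ ∘ φ` and `H± ∘ φ - s` solve the equations for
`g`. The germ `s` is the same on both petals, and both branches of the logarithm satisfy `log φ(z) =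
log z + log (φ(z)/z)`, so both corrections cancel in `R₊ - R₋`. The same pair of germs is therefore
a `1`-moment of `g` (`IsOneMoment.of_conjugatesBy`). Equality of moments follows by symmetry,
because `φ = Id + r' ∘ g - r'` with `r' = -r ∘ φ`.

Two transports need work. Gevrey bounds survive composition with `φ` (`HasGevreyExpansion.comp`),
and the preimage of a petal contains a petal (`IsPetal.exists_pullback`), cut out with regions
bounded by parabolas in the coordinate `d / z`.

For non-injectivity take `r = z²`. The commutator of `f` and `z + f² - z²` begins with `2 z⁴`
(`IsModelGerm.exists_commutator`): its order keeps the conjugate prenormalized, and its nonvanishing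
makes it differ from `f`. -/

/-! ### Taylor remainders, sectors and Gevrey expansions -/

/-- Taylor expansion at `0` of a bounded holomorphic function, with geometric remainder bounds. -/
theorem exists_taylor_bound {v : ℂ → ℂ} {ρ M : ℝ} (hρ : 0 < ρ)
    (hv : DifferentiableOn ℂ v (Metric.ball 0 ρ)) (hM : ∀ z ∈ Metric.ball (0 : ℂ) ρ, ‖v z‖ ≤ M) :
    ∃ c : ℕ → ℂ, ∀ (m : ℕ), ∀ z ∈ Metric.ball (0 : ℂ) ρ,
      ‖v z - ∑ j ∈ Finset.range m, c j * z ^ j‖ ≤ M * (2 / ρ) ^ m * ‖z‖ ^ m := by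
  have hnhds : Metric.ball (0 : ℂ) ρ ∈ 𝓝 (0 : ℂ) := Metric.ball_mem_nhds _ hρ
  set w : ℕ → ℂ → ℂ := fun j => (fun u : ℂ → ℂ => dslope u 0)^[j] v with hw
  have hsucc : ∀ j, w (j + 1) = dslope (w j) 0 := fun j => by
    simp only [hw, Function.iterate_succ_apply']
  have hdiff : ∀ j, DifferentiableOn ℂ (w j) (Metric.ball 0 ρ) := by
    intro j
    induction j with
    | zero => exact hv
    | succ j ih => rw [hsucc]; exact (Complex.differentiableOn_dslope hnhds).mpr ih
  have hbound : ∀ j, ∀ z ∈ Metric.ball (0 : ℂ) ρ, ‖w j z‖ ≤ M * (2 / ρ) ^ j := by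
    intro j
    induction j with
    | zero => simpa [hw] using hM
    | succ j ih =>
      intro z hz
      rw [hsucc]
      -- The Schwarz lemma bounds the slope through the oscillation around `w j 0`, at most twice
      -- the bound on `w j`; hence the ratio `2 / ρ`.
      have key := Complex.norm_dslope_le_div_of_mapsTo_ball (c := 0) (R₁ := ρ)
        (R₂ := 2 * (M * (2 / ρ) ^ j)) (hdiff j) (fun y hy => by
          rw [mem_closedBall_iff_norm]
          have h1 := ih y hy
          have h2 := ih 0 (Metric.mem_ball_self hρ)
          linarith [norm_sub_le (w j y) (w j 0)]) hz
      refine key.trans (le_of_eq ?_)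
      rw [pow_succ]; ring
  have hexp : ∀ m z, v z = ∑ j ∈ Finset.range m, w j 0 * z ^ j + z ^ m * w m z := by
    intro m z
    induction m with
    | zero => simp [hw]
    | succ m ih =>
      have h := sub_smul_dslope (w m) 0 z
      rw [sub_zero, smul_eq_mul, ← hsucc] at h
      rw [Finset.sum_range_succ, ih]
      linear_combination (-z ^ m) * h
  refine ⟨fun j => w j 0, fun m z hz => ?_⟩
  rw [hexp m z, add_sub_cancel_left, norm_mul, norm_pow, mul_comm]
  exact mul_le_mul_of_nonneg_right (hbound m z hz) (by positivity)

theorem AnalyticAt.exists_ball_differentiableOn_bounded {v : ℂ → ℂ} (hv : AnalyticAt ℂ v 0) :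
    ∃ ρ M : ℝ, 0 < ρ ∧ 0 < M ∧ DifferentiableOn ℂ v (Metric.ball 0 ρ) ∧
      ∀ z ∈ Metric.ball (0 : ℂ) ρ, ‖v z‖ ≤ M := by
  have h1 : ∀ᶠ z in 𝓝 (0 : ℂ), AnalyticAt ℂ v z := hv.eventually_analyticAt
  have h2 : ∀ᶠ z in 𝓝 (0 : ℂ), ‖v z‖ < ‖v 0‖ + 1 :=
    hv.continuousAt.norm.eventually (gt_mem_nhds (lt_add_one _))
  obtain ⟨ρ, hρ, h⟩ := Metric.eventually_nhds_iff_ball.mp (h1.and h2)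
  exact ⟨ρ, ‖v 0‖ + 1, hρ, by positivity,
    fun z hz => (h z hz).1.differentiableAt.differentiableWithinAt, fun z hz => (h z hz).2.le⟩

theorem sector_subset_sector {d : ℂ} {θ θ' ρ ρ' : ℝ} (hθ : θ ≤ θ') (hρ : ρ ≤ ρ') :
    sector d θ ρ ⊆ sector d θ' ρ' :=
  fun _ hz => ⟨hz.1, hz.2.1.trans_le hρ, hz.2.2.trans_le hθ⟩

theorem ofReal_mul_mem_sector {d : ℂ} (hd : ‖d‖ = 1) {θ ρ t : ℝ} (hθ : 0 < θ) (ht : 0 < t)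
    (htρ : t < ρ) : (t : ℂ) * d ∈ sector d θ ρ := by
  have hd0 : d ≠ 0 := norm_ne_zero_iff.mp (by rw [hd]; exact one_ne_zero)
  refine ⟨mul_ne_zero (by exact_mod_cast ht.ne') hd0, ?_, ?_⟩
  · rwa [norm_mul, hd, mul_one, Complex.norm_of_nonneg ht.le]
  · rw [mul_div_cancel_right₀ _ hd0, Complex.arg_ofReal_of_nonneg ht.le, abs_zero]
    exact hθ

namespace HasGevreyExpansion

theorem of_analyticAt {R : ℂ → ℂ} (d : ℂ) (hR : AnalyticAt ℂ R 0) : HasGevreyExpansion d R := by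
  obtain ⟨ρ, M, hρ, hM, hd, hb⟩ := hR.exists_ball_differentiableOn_bounded
  obtain ⟨c, hc⟩ := exists_taylor_bound hρ hd hb
  refine ⟨c, fun θ _ _ => ⟨ρ, M, 2 / ρ, hρ, hM, by positivity, fun z hz N => ?_⟩⟩
  refine (hc N z (by simpa using hz.2.1)).trans ?_
  have h1 : (1 : ℝ) ≤ N.factorial := by exact_mod_cast N.factorial_pos
  exact mul_le_mul_of_nonneg_right (le_mul_of_one_le_right (by positivity) h1) (by positivity)

theorem congr {d : ℂ} {R S : ℂ → ℂ} (hR : HasGevreyExpansion d R)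
    (h : ∀ θ : ℝ, 0 < θ → θ < Real.pi → ∃ ρ : ℝ, 0 < ρ ∧ ∀ z ∈ sector d θ ρ, S z = R z) :
    HasGevreyExpansion d S := by
  obtain ⟨a, ha⟩ := hR
  refine ⟨a, fun θ h0 hπ => ?_⟩
  obtain ⟨ρ, C, A, hρ, hC, hA, hb⟩ := ha θ h0 hπ
  obtain ⟨ρ', hρ', he⟩ := h θ h0 hπ
  refine ⟨min ρ ρ', C, A, lt_min hρ hρ', hC, hA, fun z hz N => ?_⟩
  rw [he z (sector_subset_sector le_rfl (min_le_right _ _) hz)]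
  exact hb z (sector_subset_sector le_rfl (min_le_left _ _) hz) N

theorem sub {d : ℂ} {R S : ℂ → ℂ} (hR : HasGevreyExpansion d R) (hS : HasGevreyExpansion d S) :
    HasGevreyExpansion d (fun z => R z - S z) := by
  obtain ⟨a, ha⟩ := hR
  obtain ⟨b, hb⟩ := hS
  refine ⟨fun n => a n - b n, fun θ h0 hπ => ?_⟩
  obtain ⟨ρ, C, A, hρ, hC, hA, h1⟩ := ha θ h0 hπ
  obtain ⟨ρ', C', A', hρ', hC', hA', h2⟩ := hb θ h0 hπ
  refine ⟨min ρ ρ', C + C', max A A', lt_min hρ hρ', add_pos hC hC', lt_max_of_lt_left hA,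
    fun z hz N => ?_⟩
  have e1 := h1 z (sector_subset_sector le_rfl (min_le_left _ _) hz) N
  have e2 := h2 z (sector_subset_sector le_rfl (min_le_right _ _) hz) N
  have e3 : R z - S z - ∑ n ∈ Finset.range N, (a n - b n) * z ^ n
      = (R z - ∑ n ∈ Finset.range N, a n * z ^ n)
        - (S z - ∑ n ∈ Finset.range N, b n * z ^ n) := by
    simp only [sub_mul, Finset.sum_sub_distrib]; ring
  rw [e3]
  refine (norm_sub_le _ _).trans ((add_le_add e1 e2).trans ?_)
  rw [add_mul, add_mul, add_mul]
  gcongr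
  · exact le_max_left _ _
  · exact le_max_right _ _

/-- The coefficients of a Gevrey expansion grow at most like `n!` times a geometric sequence. -/
theorem norm_coeff_le {d : ℂ} (hd : ‖d‖ = 1) {R : ℂ → ℂ} {a : ℕ → ℂ} {θ ρ C A : ℝ}
    (hθ : 0 < θ) (hρ : 0 < ρ)
    (h : ∀ z ∈ sector d θ ρ, ∀ N : ℕ,
      ‖R z - ∑ n ∈ Finset.range N, a n * z ^ n‖ ≤ C * A ^ N * (N.factorial : ℝ) * ‖z‖ ^ N)
    (N : ℕ) : ‖a N‖ ≤ C * A ^ N * (N.factorial : ℝ) := by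
  -- The term `a N * z ^ N` is a difference of consecutive remainders; divide by `t ^ N` and let `z
  -- = t d` tend to `0`.
  have hlim : Tendsto (fun t : ℝ => C * A ^ N * (N.factorial : ℝ)
      + C * A ^ (N + 1) * ((N + 1).factorial : ℝ) * t) (𝓝[>] 0)
      (𝓝 (C * A ^ N * (N.factorial : ℝ))) := by
    have : Continuous (fun t : ℝ => C * A ^ N * (N.factorial : ℝ)
      + C * A ^ (N + 1) * ((N + 1).factorial : ℝ) * t) := by fun_prop
    simpa using (this.tendsto 0).mono_left nhdsWithin_le_nhds
  refine ge_of_tendsto hlim ?_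
  filter_upwards [Ioo_mem_nhdsGT hρ] with t ht
  have hz := ofReal_mul_mem_sector hd hθ ht.1 ht.2
  set z : ℂ := (t : ℂ) * d with hzdef
  have hnz : ‖z‖ = t := by rw [hzdef, norm_mul, hd, mul_one, Complex.norm_of_nonneg ht.1.le]
  have e1 := h z hz N
  have e2 := h z hz (N + 1)
  have e3 : a N * z ^ N = (R z - ∑ n ∈ Finset.range N, a n * z ^ n)
      - (R z - ∑ n ∈ Finset.range (N + 1), a n * z ^ n) := by
    rw [Finset.sum_range_succ]; ring
  have e4 : ‖a N‖ * t ^ N ≤ (C * A ^ N * (N.factorial : ℝ)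
      + C * A ^ (N + 1) * ((N + 1).factorial : ℝ) * t) * t ^ N := by
    have := norm_sub_le (R z - ∑ n ∈ Finset.range N, a n * z ^ n)
      (R z - ∑ n ∈ Finset.range (N + 1), a n * z ^ n)
    rw [← e3, norm_mul, norm_pow, hnz] at this
    rw [hnz] at e1 e2
    refine (this.trans (add_le_add e1 e2)).trans (le_of_eq ?_)
    ring
  exact le_of_mul_le_mul_right e4 (pow_pos ht.1 N)

end HasGevreyExpansion

/-! ### Changes of variable tangent to the identity -/

/-- A germ tangent to the identity is `z` times an analytic unit. -/
theorem IsTangentToId.exists_eq_mul {φ : ℂ → ℂ} (hφ : IsTangentToId φ) :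
    ∃ u : ℂ → ℂ, AnalyticAt ℂ u 0 ∧ u 0 = 1 ∧ ∀ z, φ z = z * u z := by
  obtain ⟨ha, h0, h1⟩ := hφ
  refine ⟨dslope φ 0, ?_, by rw [dslope_same, h1], fun z => ?_⟩
  · obtain ⟨ρ, M, hρ, -, hd, -⟩ := ha.exists_ball_differentiableOn_bounded
    exact ((Complex.differentiableOn_dslope (Metric.ball_mem_nhds _ hρ)).mpr hd).analyticAt
      (Metric.ball_mem_nhds _ hρ)
  · have := sub_smul_dslope φ 0 z
    rw [h0, sub_zero, sub_zero, smul_eq_mul] at this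
    exact this.symm

/-- Multiplication by a factor close to `1` maps a small sector into a slightly larger one, and
does not cross the branch cut. -/
theorem exists_sector_mul_mem {u : ℂ → ℂ} (hu : ContinuousAt u 0) (hu1 : u 0 = 1) {d : ℂ}
    (hd : ‖d‖ = 1) {θ θ' ρ : ℝ} (hθ : θ < θ') (hθ' : θ' ≤ Real.pi) (hρ : 0 < ρ) :
    ∃ ρ' : ℝ, 0 < ρ' ∧ ρ' ≤ ρ ∧ ∀ z ∈ sector d θ ρ', z * u z ∈ sector d θ' ρ ∧
      Complex.log (z * u z / d) = Complex.log (z / d) + Complex.log (u z) := by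
  have hd0 : d ≠ 0 := norm_ne_zero_iff.mp (by rw [hd]; exact one_ne_zero)
  have hmul : ContinuousAt (fun z => z * u z) 0 := by fun_prop
  have hargc : ContinuousAt (fun z => |(u z).arg|) 0 := by
    have : ContinuousAt Complex.arg (u 0) := by
      rw [hu1]; exact Complex.continuousAt_arg Complex.one_mem_slitPlane
    exact (ContinuousAt.comp this hu).abs
  have E1 : ∀ᶠ z in 𝓝 (0 : ℂ), ‖z * u z‖ < ρ :=
    hmul.norm.eventually (gt_mem_nhds (by simpa using hρ))
  have E2 : ∀ᶠ z in 𝓝 (0 : ℂ), |(u z).arg| < θ' - θ :=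
    hargc.eventually (gt_mem_nhds (by simpa [hu1] using hθ))
  have E3 : ∀ᶠ z in 𝓝 (0 : ℂ), u z ≠ 0 := hu.eventually_ne (by rw [hu1]; exact one_ne_zero)
  obtain ⟨ε, hε, h⟩ := Metric.eventually_nhds_iff_ball.mp (E1.and (E2.and E3))
  refine ⟨min ε ρ, lt_min hε hρ, min_le_right _ _, fun z hz => ?_⟩
  obtain ⟨h1, h2, h3⟩ := h z (by simpa using hz.2.1.trans_le (min_le_left _ _))
  have hzd : z / d ≠ 0 := div_ne_zero hz.1 hd0
  have heq : z * u z / d = z / d * u z := by ring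
  have h4 := hz.2.2
  rw [abs_lt] at h2 h4
  -- As `θ' ≤ π`, the two arguments add without wrapping, so `arg` and `log` are exactly additive
  -- here.
  have hmem : (z / d).arg + (u z).arg ∈ Set.Ioc (-Real.pi) Real.pi :=
    ⟨by linarith, by linarith⟩
  refine ⟨⟨mul_ne_zero hz.1 h3, h1, ?_⟩, ?_⟩
  · rw [heq, Complex.arg_mul hzd h3 hmem, abs_lt]
    constructor <;> linarith
  · rw [heq, Complex.log_mul hzd h3 hmem]

/-- Gevrey expansions are stable under changes of variable tangent to the identity. -/
theorem HasGevreyExpansion.comp {d : ℂ} (hd : ‖d‖ = 1) {R φ : ℂ → ℂ} (hφ : IsTangentToId φ)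
    (hR : HasGevreyExpansion d R) : HasGevreyExpansion d (fun z => R (φ z)) := by
  obtain ⟨u, hu, hu1, hφu⟩ := hφ.exists_eq_mul
  obtain ⟨ε, M, hε, hM, hud, hub⟩ := hu.exists_ball_differentiableOn_bounded
  have hpow : ∀ n : ℕ, ∃ c : ℕ → ℂ, ∀ m : ℕ, ∀ z ∈ Metric.ball (0 : ℂ) ε,
      ‖u z ^ n - ∑ j ∈ Finset.range m, c j * z ^ j‖ ≤ M ^ n * (2 / ε) ^ m * ‖z‖ ^ m := fun n =>
    exists_taylor_bound hε (hud.pow n) fun z hz => by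
      rw [norm_pow]; exact pow_le_pow_left₀ (norm_nonneg _) (hub z hz) n
  choose c hc using hpow
  obtain ⟨a, ha⟩ := hR
  -- Coefficients of the formal composition, read from `φ z ^ k = z ^ k * u z ^ k`.
  refine ⟨fun m => ∑ k ∈ Finset.range (m + 1), a k * c k (m - k), fun θ h0 hπ => ?_⟩
  obtain ⟨ρ, C, A, hρ, hC, hA, hb⟩ := ha ((θ + Real.pi) / 2) (by linarith) (by linarith)
  obtain ⟨ρ', hρ', -, hsec⟩ := exists_sector_mul_mem (θ := θ) hu.continuousAt hu1 hd
    (show θ < (θ + Real.pi) / 2 by linarith) (by linarith) hρ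
  have hcoef := HasGevreyExpansion.norm_coeff_le hd (by linarith) hρ hb
  set B : ℝ := 2 / ε with hB
  have hBpos : 0 < B := by positivity
  -- There are `N + 1` error terms, each at most `C (A M + B)^N N! ‖z‖^N`; the factors `2` absorb `1
  -- + N ≤ 2 * 2 ^ N`.
  refine ⟨min ρ' ε, 2 * C, 2 * (A * M + B), lt_min hρ' hε, by positivity, by positivity,
    fun z hz N => ?_⟩
  have hzε : z ∈ Metric.ball (0 : ℂ) ε := by simpa using hz.2.1.trans_le (min_le_right _ _)
  have hzφ := (hsec z (sector_subset_sector le_rfl (min_le_left _ _) hz)).1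
  rw [← hφu] at hzφ
  have hsum : ∑ m ∈ Finset.range N, (∑ k ∈ Finset.range (m + 1), a k * c k (m - k)) * z ^ m
      = ∑ n ∈ Finset.range N, a n * z ^ n * ∑ j ∈ Finset.range (N - n), c n j * z ^ j := by
    have := Finset.sum_range_diag_flip N (fun n j => a n * z ^ n * (c n j * z ^ j))
    simp only [Finset.mul_sum]
    rw [← this]
    refine Finset.sum_congr rfl fun m _ => ?_
    rw [Finset.sum_mul]
    refine Finset.sum_congr rfl fun k hk => ?_
    have : z ^ m = z ^ k * z ^ (m - k) := by
      rw [← pow_add, Nat.add_sub_cancel' (Nat.lt_succ_iff.mp (Finset.mem_range.mp hk))]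
    rw [this]; ring
  have hsplit : R (φ z) - ∑ n ∈ Finset.range N, a n * z ^ n * ∑ j ∈ Finset.range (N - n), c n j * z ^ j
      = (R (φ z) - ∑ n ∈ Finset.range N, a n * φ z ^ n)
        + ∑ n ∈ Finset.range N, a n * z ^ n *
          (u z ^ n - ∑ j ∈ Finset.range (N - n), c n j * z ^ j) := by
    simp only [mul_sub, Finset.sum_sub_distrib, hφu, mul_pow, mul_assoc]
    ring
  have hfirst : ‖R (φ z) - ∑ n ∈ Finset.range N, a n * φ z ^ n‖
      ≤ C * (A * M + B) ^ N * (N.factorial : ℝ) * ‖z‖ ^ N := by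
    refine (hb _ hzφ N).trans ?_
    have h1 : ‖φ z‖ ≤ M * ‖z‖ := by
      rw [hφu, norm_mul, mul_comm]
      exact mul_le_mul_of_nonneg_right (hub z hzε) (norm_nonneg _)
    calc C * A ^ N * (N.factorial : ℝ) * ‖φ z‖ ^ N
        ≤ C * A ^ N * (N.factorial : ℝ) * (M * ‖z‖) ^ N := by gcongr
      _ = C * (A * M) ^ N * (N.factorial : ℝ) * ‖z‖ ^ N := by rw [mul_pow, mul_pow]; ring
      _ ≤ _ := by gcongr; linarith
  have hterm : ∀ n ∈ Finset.range N, ‖a n * z ^ n *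
      (u z ^ n - ∑ j ∈ Finset.range (N - n), c n j * z ^ j)‖
      ≤ C * (A * M + B) ^ N * (N.factorial : ℝ) * ‖z‖ ^ N := by
    intro n hn
    have hnN : n ≤ N := (Finset.mem_range.mp hn).le
    have hfac : (n.factorial : ℝ) ≤ N.factorial := by exact_mod_cast Nat.factorial_le hnN
    rw [norm_mul, norm_mul, norm_pow]
    calc ‖a n‖ * ‖z‖ ^ n * ‖u z ^ n - ∑ j ∈ Finset.range (N - n), c n j * z ^ j‖
        ≤ (C * A ^ n * (n.factorial : ℝ)) * ‖z‖ ^ n * (M ^ n * B ^ (N - n) * ‖z‖ ^ (N - n)) := by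
          gcongr
          · exact hcoef n
          · exact hc n (N - n) z hzε
      _ = C * ((A * M) ^ n * B ^ (N - n)) * (n.factorial : ℝ) * (‖z‖ ^ n * ‖z‖ ^ (N - n)) := by
          rw [mul_pow]; ring
      _ ≤ C * ((A * M + B) ^ n * (A * M + B) ^ (N - n)) * (N.factorial : ℝ) *
            (‖z‖ ^ n * ‖z‖ ^ (N - n)) := by
          have : 0 < A * M := by positivity
          gcongr <;> linarith
      _ = _ := by rw [← pow_add, ← pow_add, Nat.add_sub_cancel' hnN]
  rw [hsum, hsplit]
  refine (norm_add_le _ _).trans ((add_le_add hfirst ((norm_sum_le _ _).trans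
    (Finset.sum_le_card_nsmul _ _ _ hterm))).trans ?_)
  rw [Finset.card_range, nsmul_eq_mul]
  have hN : (1 : ℝ) + N ≤ 2 * 2 ^ N := by
    have h1 : N < 2 ^ N := Nat.lt_two_pow_self
    have h2 : (N : ℝ) < 2 ^ N := by exact_mod_cast h1
    have h3 : (1 : ℝ) ≤ 2 ^ N := one_le_pow₀ (by norm_num)
    linarith
  calc _ = (1 + (N : ℝ)) * (C * (A * M + B) ^ N * (N.factorial : ℝ) * ‖z‖ ^ N) := by ring
    _ ≤ (2 * 2 ^ N) * (C * (A * M + B) ^ N * (N.factorial : ℝ) * ‖z‖ ^ N) := by gcongr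
    _ = _ := by rw [mul_pow 2]; ring

/-! ### Invariant parabolic regions and pullback of petals -/

/-- In the coordinate `w = d / z`, the map `F` is `w ↦ w + 1 + O(w⁻²)` near infinity. -/
def IsNearTranslation (d : ℂ) (F : ℂ → ℂ) : Prop :=
  ∃ K : ℝ, ∀ᶠ z in 𝓝 (0 : ℂ), z ≠ 0 → F z ≠ 0 ∧ ‖d / F z - d / z - 1‖ ≤ K * ‖z‖ ^ 2

/-- The function whose superlevel sets are complements of parabolas around the negative reals. -/
def parabolicHeight (w : ℂ) : ℝ := w.re + w.im ^ 2

theorem parabolicHeight_le (w : ℂ) : parabolicHeight w ≤ ‖w‖ + ‖w‖ ^ 2 := by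
  have h1 := Complex.re_le_norm w
  have h2 := Complex.abs_im_le_norm w
  have h3 : w.im ^ 2 ≤ ‖w‖ ^ 2 := by rw [← sq_abs]; gcongr
  exact add_le_add h1 h3

theorem norm_lt_of_lt_parabolicHeight {d z : ℂ} (hd : ‖d‖ = 1) {R : ℝ} (hR : 0 < R)
    (h : R + R ^ 2 < parabolicHeight (d / z)) : z ≠ 0 ∧ ‖z‖ < 1 / R := by
  have h0 : z ≠ 0 := by
    rintro rfl
    simp only [div_zero, parabolicHeight, Complex.zero_re, Complex.zero_im] at h
    nlinarith
  have hlt : R < ‖d / z‖ := by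
    by_contra hle
    rw [not_lt] at hle
    have h1 := parabolicHeight_le (d / z)
    have h2 : ‖d / z‖ ^ 2 ≤ R ^ 2 := by gcongr
    linarith
  rw [norm_div, hd] at hlt
  exact ⟨h0, (lt_one_div hR (norm_pos_iff.mpr h0)).mp hlt⟩

/-- For `w' = w + 1 + e` the height gains `1 + Re e + 2 Im w Im e + (Im e)²`, and the possible loss
is at most `‖e‖ (1 + 2‖w‖)`. An error `O(w⁻²)` thus beats the quadratic term of the height. -/
theorem parabolicHeight_add_half_le {w w' : ℂ}
    (h : ‖w' - w - 1‖ * (1 + 2 * ‖w‖) ≤ 1 / 2) :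
    parabolicHeight w + 1 / 2 ≤ parabolicHeight w' := by
  obtain ⟨e, rfl⟩ : ∃ e, w' = w + 1 + e := ⟨w' - w - 1, by ring⟩
  have he : w + 1 + e - w - 1 = e := by ring
  rw [he] at h
  have h1 := Complex.abs_re_le_norm e
  have h2 := Complex.abs_im_le_norm e
  have h3 := Complex.abs_im_le_norm w
  have h4 : |w.im * e.im| ≤ ‖w‖ * ‖e‖ := by
    rw [abs_mul]; gcongr
  simp only [parabolicHeight, Complex.add_re, Complex.add_im, Complex.one_re, Complex.one_im]
  have h5 := neg_abs_le e.re
  have h6 := neg_abs_le (w.im * e.im)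
  nlinarith [sq_nonneg e.im]

/-- A small invariant region for `F` around the direction `d`. -/
def parabolicRegion (d : ℂ) (L : ℝ) : Set ℂ := {z | L < parabolicHeight (d / z)}

/-- By convention `d / 0 = 0`, which has height `0`; the bound `0 ≤ L` therefore excludes the
origin, where `d / z` is not continuous. -/
theorem isOpen_parabolicRegion {d : ℂ} {L : ℝ} (hL : 0 ≤ L) : IsOpen (parabolicRegion d L) := by
  have heq : parabolicRegion d L
      = {0}ᶜ ∩ (fun z => parabolicHeight (d / z)) ⁻¹' Set.Ioi L := by
    ext z
    simp only [parabolicRegion, Set.mem_ofPred_eq, Set.mem_inter_iff, Set.mem_compl_iff,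
      Set.mem_singleton_iff, Set.mem_preimage, Set.mem_Ioi]
    refine ⟨fun h => ⟨?_, h⟩, fun h => h.2⟩
    rintro rfl
    simp only [div_zero, parabolicHeight, Complex.zero_re, Complex.zero_im] at h
    linarith
  rw [heq]
  refine ContinuousOn.isOpen_inter_preimage ?_ isOpen_compl_singleton isOpen_Ioi
  have h1 : ContinuousOn (fun z : ℂ => d / z) {0}ᶜ :=
    continuousOn_const.div continuousOn_id fun z hz => hz
  have h2 : Continuous parabolicHeight := by unfold parabolicHeight; fun_prop
  exact h2.comp_continuousOn h1

/-- On the closed negative real axis the height is the real part, hence nonpositive; inversion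
preserves the slit plane. -/
theorem div_mem_slitPlane_of_mem_parabolicRegion {d z : ℂ} {L : ℝ} (hL : 0 ≤ L)
    (hz : z ∈ parabolicRegion d L) : z / d ∈ Complex.slitPlane := by
  have h1 : d / z ∈ Complex.slitPlane := by
    rw [Complex.mem_slitPlane_iff]
    by_contra hcon
    rw [not_or, not_lt, not_not] at hcon
    have : L < parabolicHeight (d / z) := hz
    simp only [parabolicHeight, hcon.2] at this
    linarith [hcon.1]
  have h0 : 0 < Complex.normSq (d / z) := Complex.normSq_pos.mpr (Complex.slitPlane_ne_zero h1)
  rw [← inv_div d z, Complex.mem_slitPlane_iff, Complex.inv_re, Complex.inv_im]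
  rcases (Complex.mem_slitPlane_iff).mp h1 with h2 | h2
  · exact Or.inl (by positivity)
  · exact Or.inr (div_ne_zero (neg_ne_zero.mpr h2) h0.ne')

theorem exists_parabolicRegion_mapsTo {d : ℂ} (hd : ‖d‖ = 1) {F : ℂ → ℂ}
    (hF : IsNearTranslation d F) {ε : ℝ} (hε : 0 < ε) :
    ∃ L : ℝ, 0 < L ∧ parabolicRegion d L ⊆ Metric.ball 0 ε ∧
      ∀ z ∈ parabolicRegion d L,
        parabolicHeight (d / z) + 1 / 2 ≤ parabolicHeight (d / F z) := by
  obtain ⟨K, hK⟩ := hF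
  obtain ⟨η, hη, h⟩ := Metric.eventually_nhds_iff_ball.mp hK
  -- The first two entries place the region in both balls. The last two give `‖z‖ ≤ 1` and `6 K ‖z‖
  -- ≤ 1`, so the error `K ‖z‖ (‖z‖ + 2)` is at most `1 / 2`.
  set R : ℝ := max (max (1 / ε) (1 / η)) (max 1 (6 * K)) with hR
  have hRε : 1 / ε ≤ R := (le_max_left _ _).trans (le_max_left _ _)
  have hRη : 1 / η ≤ R := (le_max_right _ _).trans (le_max_left _ _)
  have hR1 : 1 ≤ R := (le_max_left _ _).trans (le_max_right _ _)
  have hRK : 6 * K ≤ R := (le_max_right _ _).trans (le_max_right _ _)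
  have hR0 : 0 < R := by linarith
  refine ⟨R + R ^ 2, by positivity, fun z hz => ?_, fun z hz => ?_⟩
  · have h1 := (norm_lt_of_lt_parabolicHeight hd hR0 hz).2
    rw [mem_ball_zero_iff]
    exact h1.trans_le ((one_div_le hR0 hε).mpr hRε)
  · obtain ⟨hz0, hzR⟩ := norm_lt_of_lt_parabolicHeight hd hR0 hz
    have hzη : z ∈ Metric.ball (0 : ℂ) η := by
      rw [mem_ball_zero_iff]; exact hzR.trans_le ((one_div_le hR0 hη).mpr hRη)
    obtain ⟨-, hest⟩ := h z hzη hz0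
    apply parabolicHeight_add_half_le
    have ht : 0 < ‖z‖ := norm_pos_iff.mpr hz0
    rw [norm_div d z, hd]
    have htR : ‖z‖ * R < 1 := (lt_div_iff₀ hR0).mp hzR
    have ht1 : ‖z‖ ≤ 1 := by nlinarith
    have hKz : 6 * K * ‖z‖ ≤ 1 := by nlinarith
    calc ‖d / F z - d / z - 1‖ * (1 + 2 * (1 / ‖z‖))
        ≤ K * ‖z‖ ^ 2 * (1 + 2 * (1 / ‖z‖)) := by gcongr
      _ = K * ‖z‖ * (‖z‖ + 2) := by field_simp
      _ ≤ 1 / 2 := by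
        rcases le_or_gt K 0 with hK0 | hK0
        · have : K * ‖z‖ * (‖z‖ + 2) ≤ 0 :=
            mul_nonpos_of_nonpos_of_nonneg (mul_nonpos_of_nonpos_of_nonneg hK0 ht.le)
              (by positivity)
          linarith
        · have : K * ‖z‖ * (‖z‖ + 2) ≤ K * ‖z‖ * 3 := by gcongr; linarith
          linarith

theorem tendsto_iterate_of_parabolicHeight {d : ℂ} (hd : ‖d‖ = 1) {F : ℂ → ℂ} {L : ℝ}
    (hF : ∀ z ∈ parabolicRegion d L,
      parabolicHeight (d / z) + 1 / 2 ≤ parabolicHeight (d / F z))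
    {z : ℂ} (hz : z ∈ parabolicRegion d L) : Tendsto (fun n : ℕ => F^[n] z) atTop (𝓝 0) := by
  have hgrow : ∀ n : ℕ, L + n / 2 < parabolicHeight (d / F^[n] z) := by
    intro n
    induction n with
    | zero => simpa [parabolicRegion] using hz
    | succ n ih =>
      have hmem : F^[n] z ∈ parabolicRegion d L :=
        lt_of_le_of_lt (le_add_of_nonneg_right (by positivity)) ih
      rw [Function.iterate_succ_apply']
      have := hF _ hmem
      push_cast
      linarith
  rw [Metric.tendsto_atTop]
  intro ε hε
  have hR : 0 < 1 / ε := by positivity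
  obtain ⟨N, hN⟩ := exists_nat_ge (2 * (1 / ε + (1 / ε) ^ 2 - L))
  refine ⟨N, fun n hn => ?_⟩
  have hnN : (N : ℝ) ≤ n := by exact_mod_cast hn
  have h1 : 1 / ε + (1 / ε) ^ 2 < parabolicHeight (d / F^[n] z) := by
    have := hgrow n
    linarith
  rw [dist_zero_right]
  simpa using (norm_lt_of_lt_parabolicHeight hd hR h1).2

theorem exists_sector_subset_parabolicRegion {d : ℂ} (hd : ‖d‖ = 1) {L θ : ℝ} (hL : 0 < L)
    (h0 : 0 < θ) (hπ : θ < Real.pi) : ∃ ρ : ℝ, 0 < ρ ∧ sector d θ ρ ⊆ parabolicRegion d L := by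
  have hd0 : d ≠ 0 := norm_ne_zero_iff.mp (by rw [hd]; exact one_ne_zero)
  have hcos : 0 < 1 + Real.cos θ := by
    have := Real.cos_lt_cos_of_nonneg_of_le_pi h0.le le_rfl hπ
    rw [Real.cos_pi] at this
    linarith
  refine ⟨min (1 / L) (1 + Real.cos θ), lt_min (by positivity) hcos, fun z hz => ?_⟩
  obtain ⟨hz0, hzρ, hzθ⟩ := hz
  set ζ : ℂ := z / d with hζ
  have hζ0 : ζ ≠ 0 := div_ne_zero hz0 hd0
  have hnorm : ‖z‖ = ‖ζ‖ := by rw [hζ, norm_div, hd, div_one]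
  rw [hnorm] at hzρ
  set t : ℝ := ‖ζ‖ with ht
  have ht0 : 0 < t := norm_pos_iff.mpr hζ0
  have htL : t < 1 / L := hzρ.trans_le (min_le_left _ _)
  have htc : t < 1 + Real.cos θ := hzρ.trans_le (min_le_right _ _)
  have hre : ζ.re = t * Real.cos ζ.arg := (Complex.norm_mul_cos_arg ζ).symm
  have him : ζ.im = t * Real.sin ζ.arg := (Complex.norm_mul_sin_arg ζ).symm
  have hc : Real.cos θ ≤ Real.cos ζ.arg := by
    rw [← Real.cos_abs ζ.arg]
    exact Real.cos_le_cos_of_nonneg_of_le_pi (abs_nonneg _) hπ.le hzθ.le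
  have hsq : Complex.normSq ζ = t ^ 2 := Complex.normSq_eq_norm_sq ζ
  have hw : d / z = ζ⁻¹ := by rw [hζ, inv_div]
  have hs := Real.sin_sq_add_cos_sq ζ.arg
  have hc1 := Real.cos_le_one ζ.arg
  set c := Real.cos ζ.arg
  set s := Real.sin ζ.arg
  change L < parabolicHeight (d / z)
  rw [hw, parabolicHeight, Complex.inv_re, Complex.inv_im, hsq, hre, him]
  have h1 : t * c / t ^ 2 + (-(t * s) / t ^ 2) ^ 2 = (c * t + s ^ 2) / t ^ 2 := by
    field_simp
  -- Since `t ≤ 1 + cos θ ≤ 1 + c`, one has `s² = (1 - c)(1 + c) ≥ (1 - c) t`. The height is then at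
  -- least `1 / t > L`.
  have h2 : L * t < 1 := by rw [mul_comm]; exact (lt_div_iff₀ hL).mp htL
  rw [h1, lt_div_iff₀ (by positivity)]
  have h3 : t ≤ c * t + s ^ 2 := by nlinarith
  nlinarith

theorem isPreconnected_sector {d : ℂ} (hd : ‖d‖ = 1) {θ : ℝ} (hπ : θ ≤ Real.pi)
    (ρ : ℝ) : IsPreconnected (sector d θ ρ) := by
  have hd0 : d ≠ 0 := norm_ne_zero_iff.mp (by rw [hd]; exact one_ne_zero)
  have heq : sector d θ ρ = (fun q : ℝ × ℝ => (q.1 : ℂ) * Complex.exp (q.2 * Complex.I) * d) ''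
      (Set.Ioo 0 ρ ×ˢ Set.Ioo (-θ) θ) := by
    ext z
    constructor
    · rintro ⟨h0, h1, h2⟩
      refine ⟨(‖z / d‖, (z / d).arg), ⟨⟨?_, ?_⟩, abs_lt.mp h2⟩, ?_⟩
      · exact norm_pos_iff.mpr (div_ne_zero h0 hd0)
      · simpa [norm_div, hd] using h1
      · change (‖z / d‖ : ℂ) * Complex.exp ((z / d).arg * Complex.I) * d = z
        rw [Complex.norm_mul_exp_arg_mul_I, div_mul_cancel₀ _ hd0]
    · rintro ⟨⟨t, α⟩, ⟨ht, hα⟩, rfl⟩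
      simp only [Set.mem_Ioo] at ht hα
      refine ⟨?_, ?_, ?_⟩
      · exact mul_ne_zero (mul_ne_zero (by exact_mod_cast ht.1.ne') (Complex.exp_ne_zero _)) hd0
      · simpa [hd, Complex.norm_exp_ofReal_mul_I, abs_of_pos ht.1] using ht.2
      · rw [mul_div_cancel_right₀ _ hd0, Complex.arg_real_mul _ ht.1, Complex.arg_exp_mul_I,
          (toIocMod_eq_self Real.two_pi_pos).mpr, abs_lt]
        · exact hα
        · constructor <;> linarith
  rw [heq]
  refine (isPreconnected_Ioo.prod isPreconnected_Ioo).image _ (Continuous.continuousOn ?_)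
  fun_prop

/-- Pulling back a petal by a change of variable tangent to the identity: the preimage contains a
petal, arbitrarily small, on which the branches of the logarithm are compatible. -/
theorem IsPetal.exists_pullback {d : ℂ} (hd : ‖d‖ = 1) {F G φ u : ℂ → ℂ} {V : Set ℂ}
    (hV : IsPetal d F V) (hu : AnalyticAt ℂ u 0) (hu1 : u 0 = 1) (hφ : ∀ z, φ z = z * u z)
    (hG : IsTangentToId G) (hGd : IsNearTranslation d G)
    (hconj : ∀ᶠ z in 𝓝 (0 : ℂ), φ (G z) = F (φ z)) {p : ℂ → Prop}
    (hp : ∀ᶠ z in 𝓝 (0 : ℂ), p z) :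
    ∃ W : Set ℂ, IsPetal d G W ∧ Set.MapsTo φ W V ∧ (∀ z ∈ W, p z) ∧
      DifferentiableOn ℂ φ W ∧
      ∀ z ∈ W, Complex.log (φ z / d) = Complex.log (z / d) + Complex.log (u z) := by
  have hd0 : d ≠ 0 := norm_ne_zero_iff.mp (by rw [hd]; exact one_ne_zero)
  have E1 := hu.eventually_analyticAt
  have E2 := hG.1.eventually_analyticAt
  have E3 : ∀ᶠ z in 𝓝 (0 : ℂ), u z ∈ Complex.slitPlane :=
    hu.continuousAt.eventually_mem (Complex.isOpen_slitPlane.mem_nhds (by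
      rw [hu1]; exact Complex.one_mem_slitPlane))
  obtain ⟨ε, hε, hball⟩ := Metric.eventually_nhds_iff_ball.mp
    (E1.and (E2.and (E3.and (hconj.and hp))))
  obtain ⟨L, hL, hLε, hstep⟩ := exists_parabolicRegion_mapsTo hd hGd hε
  set D := parabolicRegion d L with hD
  have hDG : Set.MapsTo G D D := fun z hz => by
    have h1 := hstep z hz
    have h2 : L < parabolicHeight (d / z) := hz
    change L < parabolicHeight (d / G z)
    linarith
  have hφD : DifferentiableOn ℂ φ D := fun z hz => by
    have := (hball z (hLε hz)).1.differentiableAt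
    rw [funext hφ]
    exact (differentiableAt_id.mul this).differentiableWithinAt
  have hGD : DifferentiableOn ℂ G D := fun z hz =>
    (hball z (hLε hz)).2.1.differentiableAt.differentiableWithinAt
  -- This set is open, invariant and contains the required sectors, but may be disconnected; `W`
  -- will be its component containing a point of the axis.
  set A : Set ℂ := D ∩ φ ⁻¹' V with hA
  have hAopen : IsOpen A := hφD.continuousOn.isOpen_inter_preimage
    (isOpen_parabolicRegion hL.le) hV.isOpen
  have hAG : Set.MapsTo G A A := fun z hz => by
    refine ⟨hDG hz.1, ?_⟩
    change φ (G z) ∈ V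
    rw [(hball z (hLε hz.1)).2.2.2.1]
    exact hV.mapsTo hz.2
  have hsecA : ∀ θ : ℝ, 0 < θ → θ < Real.pi → ∃ ρ : ℝ, 0 < ρ ∧ sector d θ ρ ⊆ A ∧
      ∀ z ∈ sector d θ ρ,
        Complex.log (φ z / d) = Complex.log (z / d) + Complex.log (u z) := by
    intro θ h0 hπ
    obtain ⟨ρ₁, hρ₁, h1⟩ := exists_sector_subset_parabolicRegion hd hL h0 hπ
    obtain ⟨ρ₂, hρ₂, h2⟩ := hV.sector_subset ((θ + Real.pi) / 2) (by linarith) (by linarith)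
    obtain ⟨ρ₃, hρ₃, -, h3⟩ := exists_sector_mul_mem (θ := θ) (θ' := (θ + Real.pi) / 2)
      hu.continuousAt hu1 hd (by linarith) (by linarith) hρ₂
    refine ⟨min ρ₁ ρ₃, lt_min hρ₁ hρ₃, fun z hz => ⟨?_, ?_⟩, fun z hz => ?_⟩
    · exact h1 (sector_subset_sector le_rfl (min_le_left _ _) hz)
    · change φ z ∈ V
      rw [hφ]
      exact h2 (h3 z (sector_subset_sector le_rfl (min_le_right _ _) hz)).1
    · rw [hφ]
      exact (h3 z (sector_subset_sector le_rfl (min_le_right _ _) hz)).2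
  have hπ0 := Real.pi_pos
  obtain ⟨ρ₀, hρ₀, hs₀, hlog₀⟩ := hsecA (Real.pi / 2) (by linarith) (by linarith)
  set z₀ : ℂ := ((ρ₀ / 2 : ℝ) : ℂ) * d with hz₀def
  have hz₀ : z₀ ∈ sector d (Real.pi / 2) ρ₀ :=
    ofReal_mul_mem_sector hd (by linarith) (by linarith) (by linarith)
  set W := connectedComponentIn A z₀ with hW
  have hWA : W ⊆ A := connectedComponentIn_subset _ _
  have hWopen : IsOpen W := hAopen.connectedComponentIn
  have hz₀W : z₀ ∈ W := mem_connectedComponentIn (hs₀ hz₀)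
  have hWconn : IsConnected W := isConnected_connectedComponentIn_iff.mpr (hs₀ hz₀)
  have hs₀W : sector d (Real.pi / 2) ρ₀ ⊆ W :=
    (isPreconnected_sector hd (by linarith) ρ₀).subset_connectedComponentIn hz₀ hs₀
  have hsecW : ∀ θ : ℝ, 0 < θ → θ < Real.pi → ∃ ρ : ℝ, 0 < ρ ∧ sector d θ ρ ⊆ W := by
    intro θ h0 hπ
    obtain ⟨ρ, hρ, hs, -⟩ := hsecA θ h0 hπ
    refine ⟨ρ, hρ, fun z hz => ?_⟩
    have hm : 0 < min ρ ρ₀ := lt_min hρ hρ₀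
    have hlt : min ρ ρ₀ / 2 < min ρ ρ₀ := by linarith
    -- Any two sectors share points of the axis, so every sector lies in the same component as `z₀`.
    have hpre := IsPreconnected.union (((min ρ ρ₀ / 2 : ℝ) : ℂ) * d)
      (ofReal_mul_mem_sector hd h0 (by linarith) (hlt.trans_le (min_le_left _ _)))
      (ofReal_mul_mem_sector hd (show 0 < Real.pi / 2 by linarith) (by linarith)
        (hlt.trans_le (min_le_right _ _)))
      (isPreconnected_sector hd hπ.le ρ)
      (isPreconnected_sector hd (show Real.pi / 2 ≤ Real.pi by linarith) ρ₀)
    exact hpre.subset_connectedComponentIn (Or.inr hz₀) (Set.union_subset hs hs₀) (Or.inl hz)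
  have hWG : Set.MapsTo G W W := by
    -- The image of `W` is connected and stays in `A`, so one point of `W` with image in `W`
    -- suffices. A point `z₁` of a narrower sector is sent into the sector already known to lie in
    -- `W`.
    obtain ⟨v, hv, hv1, hGv⟩ := hG.exists_eq_mul
    obtain ⟨ρ, hρ, hρρ₀, hs⟩ := exists_sector_mul_mem (θ := Real.pi / 4) (θ' := Real.pi / 2)
      hv.continuousAt hv1 hd (by linarith) (by linarith) hρ₀
    have hz₁ : ((ρ / 2 : ℝ) : ℂ) * d ∈ sector d (Real.pi / 4) ρ :=
      ofReal_mul_mem_sector hd (by linarith) (by linarith) (by linarith)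
    set z₁ : ℂ := ((ρ / 2 : ℝ) : ℂ) * d
    have hz₁W : z₁ ∈ W := hs₀W (sector_subset_sector (by linarith) hρρ₀ hz₁)
    have hGz₁ : G z₁ ∈ W := by
      rw [hGv]; exact hs₀W (hs z₁ hz₁).1
    have himg : IsPreconnected (G '' W) :=
      hWconn.isPreconnected.image G (hGD.continuousOn.mono (hWA.trans Set.inter_subset_left))
    have hsub : G '' W ⊆ connectedComponentIn A (G z₁) :=
      himg.subset_connectedComponentIn (Set.mem_image_of_mem G hz₁W)
        ((hAG.mono_left hWA).image_subset)
    rw [← connectedComponentIn_eq hGz₁] at hsub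
    exact Set.mapsTo_iff_image_subset.mpr hsub
  have hslit : ∀ z ∈ W, z / d ∈ Complex.slitPlane := fun z hz =>
    div_mem_slitPlane_of_mem_parabolicRegion hL.le (hWA hz).1
  refine ⟨W, ⟨hWopen, hWconn, hGD.mono (hWA.trans Set.inter_subset_left), hWG, fun z hz => ?_,
    hsecW, hslit⟩, fun z hz => (hWA hz).2, fun z hz => (hball z (hLε (hWA hz).1)).2.2.2.2,
    hφD.mono (hWA.trans Set.inter_subset_left), ?_⟩
  · exact tendsto_iterate_of_parabolicHeight hd hstep (hWA hz).1
  · have hl : DifferentiableOn ℂ (fun z => Complex.log (φ z / d)) W := fun z hz => by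
      have h1 := hφD.differentiableAt ((isOpen_parabolicRegion hL.le).mem_nhds (hWA hz).1)
      exact ((h1.div_const d).clog (hV.subset_slit _ (hWA hz).2)).differentiableWithinAt
    have hr : DifferentiableOn ℂ (fun z => Complex.log (z / d) + Complex.log (u z)) W :=
      fun z hz => by
        have h1 := hball z (hLε (hWA hz).1)
        exact (((differentiableAt_id.div_const d).clog (hslit z hz)).add
          (h1.1.differentiableAt.clog h1.2.2.1)).differentiableWithinAt
    -- The two analytic functions agree on a sector around `z₀`, hence on all of `W` by the identity
    -- theorem.
    have hev : (fun z => Complex.log (φ z / d)) =ᶠ[𝓝 z₀]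
        fun z => Complex.log (z / d) + Complex.log (u z) := by
      have harg : ContinuousAt (fun z : ℂ => |(z / d).arg|) z₀ := by
        have h1 : ContinuousAt (fun z : ℂ => z / d) z₀ := by fun_prop
        have h2 : ContinuousAt Complex.arg ((fun z : ℂ => z / d) z₀) :=
          Complex.continuousAt_arg (hslit z₀ hz₀W)
        exact (ContinuousAt.comp (g := Complex.arg) (f := fun z : ℂ => z / d) h2 h1).abs
      have e1 : ∀ᶠ z in 𝓝 z₀, z ≠ 0 := continuousAt_id.eventually_ne hz₀.1
      have e2 : ∀ᶠ z in 𝓝 z₀, ‖z‖ < ρ₀ :=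
        continuous_norm.continuousAt.eventually (gt_mem_nhds hz₀.2.1)
      have e3 := harg.eventually (gt_mem_nhds hz₀.2.2)
      filter_upwards [e1, e2, e3] with z h1 h2 h3
      exact hlog₀ z ⟨h1, h2, h3⟩
    exact (hl.analyticOnNhd hWopen).eqOn_of_preconnected_of_eventuallyEq
      (hr.analyticOnNhd hWopen) hWconn.isPreconnected hz₀W hev

/-! ### Local form of prenormalized germs and of their inverses -/

theorem IsModelGerm.map_zero {f : ℂ → ℂ} (hf : IsModelGerm f) : f 0 = 0 := by
  have := (Asymptotics.isLittleO_iff.mp hf.2 one_pos).self_of_nhds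
  simpa using this

/-- An analytic germ of order `n ≤ 3` is bounded below by a positive multiple of `‖z‖ ^ n`, so it
cannot be `o(z³)`. -/
theorem IsModelGerm.exists_remainder {f : ℂ → ℂ} (hf : IsModelGerm f) :
    ∃ h : ℂ → ℂ, AnalyticAt ℂ h 0 ∧ ∀ᶠ z in 𝓝 (0 : ℂ), f z = z + z ^ 2 + z ^ 3 + z ^ 4 * h z := by
  have hpa : AnalyticAt ℂ (fun z => f z - (z + z ^ 2 + z ^ 3)) 0 := by
    have := hf.1
    fun_prop
  have hord : ((4 : ℕ) : ℕ∞) ≤ analyticOrderAt (fun z => f z - (z + z ^ 2 + z ^ 3)) 0 := by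
    by_contra hlt
    rw [not_le] at hlt
    obtain ⟨n, hn⟩ := ENat.ne_top_iff_exists.mp (ne_top_of_lt hlt)
    rw [← hn] at hlt
    have hn4 : n ≤ 3 := by
      have : n < 4 := by exact_mod_cast hlt
      omega
    obtain ⟨q, hq, hq0, hqe⟩ := (hpa.analyticOrderAt_eq_natCast).mp hn.symm
    have hqn : 0 < ‖q 0‖ / 2 := by have := norm_pos_iff.mpr hq0; positivity
    have e1 := Asymptotics.isLittleO_iff.mp hf.2 hqn
    have e2 : ∀ᶠ z in 𝓝 (0 : ℂ), ‖q 0‖ / 2 < ‖q z‖ :=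
      hq.continuousAt.norm.eventually (lt_mem_nhds (by linarith))
    have e3 : ∀ᶠ z : ℂ in 𝓝 0, ‖z‖ < 1 :=
      continuous_norm.continuousAt.eventually (gt_mem_nhds (by simp))
    have e4 := (e1.and (e2.and (e3.and hqe))).filter_mono (nhdsWithin_le_nhds (s := {(0 : ℂ)}ᶜ))
    obtain ⟨z, ⟨h1, h2, h3, h4⟩, hz⟩ := (e4.and self_mem_nhdsWithin).exists
    have hz0 : 0 < ‖z‖ := norm_pos_iff.mpr hz
    rw [h4, sub_zero, smul_eq_mul, norm_mul, norm_pow, norm_pow] at h1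
    have h5 : ‖z‖ ^ 3 ≤ ‖z‖ ^ n := pow_le_pow_of_le_one hz0.le h3.le hn4
    have h6 : 0 < ‖z‖ ^ n := pow_pos hz0 n
    nlinarith
  obtain ⟨h, hh, he⟩ := (natCast_le_analyticOrderAt hpa).mp hord
  refine ⟨h, hh, he.mono fun z hz => ?_⟩
  rw [sub_zero, smul_eq_mul] at hz
  linear_combination hz

theorem IsModelGerm.isTangentToId {f : ℂ → ℂ} (hf : IsModelGerm f) : IsTangentToId f := by
  refine ⟨hf.1, hf.map_zero, ?_⟩
  obtain ⟨h, hh, he⟩ := hf.exists_remainder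
  have hd : HasDerivAt (fun z : ℂ => z + z ^ 2 + z ^ 3 + z ^ 4 * h z)
      (1 + (2 : ℕ) * (0 : ℂ) ^ (2 - 1) + (3 : ℕ) * (0 : ℂ) ^ (3 - 1)
        + ((4 : ℕ) * (0 : ℂ) ^ (4 - 1) * h 0 + 0 ^ 4 * deriv h 0)) 0 :=
    (((hasDerivAt_id (0 : ℂ)).add (hasDerivAt_pow 2 _)).add (hasDerivAt_pow 3 _)).add
      ((hasDerivAt_pow 4 _).mul hh.differentiableAt.hasDerivAt)
  have he' : f =ᶠ[𝓝 0] fun z => z + z ^ 2 + z ^ 3 + z ^ 4 * h z := he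
  rw [he'.deriv_eq, hd.deriv]
  norm_num

theorem IsTangentToId.tendsto {φ : ℂ → ℂ} (hφ : IsTangentToId φ) : Tendsto φ (𝓝 0) (𝓝 0) := by
  have := hφ.1.continuousAt.tendsto
  rwa [hφ.2.1] at this

theorem IsTangentToId.eventually_ne {φ : ℂ → ℂ} (hφ : IsTangentToId φ) :
    ∀ᶠ z in 𝓝 (0 : ℂ), z ≠ 0 → φ z ≠ 0 := by
  obtain ⟨u, hu, hu1, he⟩ := hφ.exists_eq_mul
  filter_upwards [hu.continuousAt.eventually_ne (by rw [hu1]; exact one_ne_zero)] with z hz hz0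
  rw [he]; exact mul_ne_zero hz0 hz

theorem IsTangentToId.comp {φ χ : ℂ → ℂ} (hφ : IsTangentToId φ) (hχ : IsTangentToId χ) :
    IsTangentToId (fun z => φ (χ z)) := by
  have h1 : AnalyticAt ℂ φ (χ 0) := by rw [hχ.2.1]; exact hφ.1
  refine ⟨h1.comp hχ.1, by simp only [hχ.2.1, hφ.2.1], ?_⟩
  have h2 : HasDerivAt (φ ∘ χ) _ 0 :=
    h1.differentiableAt.hasDerivAt.comp 0 hχ.1.differentiableAt.hasDerivAt
  change deriv (φ ∘ χ) 0 = 1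
  rw [h2.deriv, hχ.2.1, hφ.2.2, hχ.2.2, one_mul]

theorem IsInverseGerm.isTangentToId {f k : ℂ → ℂ} (hf : IsTangentToId f) (hk : IsInverseGerm f k) :
    IsTangentToId k := by
  obtain ⟨hka, hk0, he⟩ := hk
  refine ⟨hka, hk0, ?_⟩
  have h1 : HasDerivAt f (deriv f 0) (k 0) := by
    rw [hk0]; exact hf.1.differentiableAt.hasDerivAt
  have h2 := h1.comp 0 hka.differentiableAt.hasDerivAt
  have h3 : f ∘ k =ᶠ[𝓝 0] id := he.mono fun z hz => hz.2
  have h4 := h3.deriv_eq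
  rw [h2.deriv, hf.2.2, one_mul] at h4
  rw [h4]; simp

theorem IsInverseGerm.symm {f k : ℂ → ℂ} (hf : IsTangentToId f) (hk : IsInverseGerm f k) :
    IsInverseGerm k f :=
  ⟨hf.1, hf.2.1, hk.2.2.mono fun _ h => ⟨h.2, h.1⟩⟩

/-- The coefficient `1` of `z³` cancels the term of order `z` in `-1 / f z + 1 / z - 1`, leaving
`O(z²)`. -/
theorem IsModelGerm.isNearTranslation {f : ℂ → ℂ} (hf : IsModelGerm f) :
    IsNearTranslation (-1) f := by
  obtain ⟨h, hh, he⟩ := hf.exists_remainder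
  set q : ℂ → ℂ := fun z => 1 + z + z ^ 2 + z ^ 3 * h z with hq
  set b : ℂ → ℂ := fun z => (h z - 1 - z * h z) / q z with hb
  have hqc : ContinuousAt q 0 := by have := hh.continuousAt; fun_prop
  have hq0 : q 0 = 1 := by simp [hq]
  have hbc : ContinuousAt b 0 := by
    have := hh.continuousAt
    exact ContinuousAt.div (by fun_prop) hqc (by rw [hq0]; exact one_ne_zero)
  refine ⟨‖b 0‖ + 1, ?_⟩
  filter_upwards [he, hqc.eventually_ne (by rw [hq0]; exact one_ne_zero),
    hbc.norm.eventually (gt_mem_nhds (lt_add_one _))] with z h1 h2 h3 hz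
  have hfz : f z = z * q z := by rw [h1, hq]; ring
  refine ⟨by rw [hfz]; exact mul_ne_zero hz h2, ?_⟩
  have heq : -1 / f z - -1 / z - 1 = b z * z ^ 2 := by
    have hqz : q z = 1 + z + z ^ 2 + z ^ 3 * h z := rfl
    rw [hfz]
    simp only [hb]
    field_simp
    rw [hqz]
    ring
  rw [heq, norm_mul, norm_pow]
  gcongr

/-- Substituting `k z` in the estimate for `f` swaps source and image, which turns the direction
`-1` into `1`. The factor `4` comes from `‖k z‖ ≤ 2 ‖z‖`. -/
theorem IsNearTranslation.inverse {f k : ℂ → ℂ} (hf : IsTangentToId f)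
    (hfd : IsNearTranslation (-1) f) (hk : IsInverseGerm f k) : IsNearTranslation 1 k := by
  obtain ⟨K, hK⟩ := hfd
  have hkt := hk.isTangentToId hf
  obtain ⟨u, hu, hu1, hku⟩ := hkt.exists_eq_mul
  refine ⟨|K| * 4, ?_⟩
  have e1 : ∀ᶠ z in 𝓝 (0 : ℂ), ‖u z‖ < 2 :=
    hu.continuousAt.norm.eventually (gt_mem_nhds (by simp [hu1]))
  filter_upwards [hkt.tendsto.eventually hK, hk.2.2, hkt.eventually_ne, e1] with z h1 h2 h3 h4 hz
  refine ⟨h3 hz, ?_⟩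
  obtain ⟨-, h5⟩ := h1 (h3 hz)
  rw [h2.2] at h5
  have heq : 1 / k z - 1 / z - 1 = -1 / z - -1 / k z - 1 := by ring
  rw [heq]
  have h6 : ‖k z‖ ≤ 2 * ‖z‖ := by
    rw [hku, norm_mul, mul_comm]
    exact mul_le_mul_of_nonneg_right h4.le (norm_nonneg _)
  calc _ ≤ K * ‖k z‖ ^ 2 := h5
    _ ≤ |K| * (2 * ‖z‖) ^ 2 := by gcongr; exact le_abs_self K
    _ = _ := by ring

/-! ### Branches of the logarithm and transport of solutions -/

theorem logPlus_eq_log_div (z : ℂ) :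
    logPlus z = Complex.log (z / -1) + Real.pi * Complex.I := by
  rw [logPlus, div_neg, div_one]

theorem logPlus_of_im_pos {z : ℂ} (hz : 0 < z.im) : logPlus z = Complex.log z := by
  rw [logPlus, Complex.log, Complex.log, norm_neg, Complex.arg_neg_eq_arg_sub_pi_of_im_pos hz]
  push_cast; ring

theorem logPlus_of_im_neg {z : ℂ} (hz : z.im < 0) :
    logPlus z = Complex.log z + 2 * Real.pi * Complex.I := by
  rw [logPlus, Complex.log, Complex.log, norm_neg, Complex.arg_neg_eq_arg_add_pi_of_im_neg hz]
  push_cast; ring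

theorem im_ne_zero_of_mem_slitPlane {z : ℂ} (h1 : z / 1 ∈ Complex.slitPlane)
    (h2 : z / -1 ∈ Complex.slitPlane) : z.im ≠ 0 := by
  intro h0
  rw [div_one, Complex.mem_slitPlane_iff] at h1
  rw [div_neg, div_one, Complex.mem_slitPlane_iff, Complex.neg_re, Complex.neg_im] at h2
  have h3 := h1.resolve_right (not_not.mpr h0)
  have h4 := h2.resolve_right (by simpa using h0)
  linarith

/-- The difference of the two branches is `0` above the real axis and `2πi` below. Since `φ`
preserves this difference on the pulled-back petals, it detects that `φ z` lies on the same side as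
`z`. -/
theorem im_pos_of_logPlus_eq {z : ℂ} (hz : z.im ≠ 0) (h : logPlus z = Complex.log z) :
    0 < z.im := by
  rcases lt_or_gt_of_ne hz with h1 | h1
  · rw [logPlus_of_im_neg h1, add_eq_left] at h
    exact absurd h Complex.two_pi_I_ne_zero
  · exact h1

theorem im_neg_of_logPlus_eq {z : ℂ} (hz : z.im ≠ 0)
    (h : logPlus z = Complex.log z + 2 * Real.pi * Complex.I) : z.im < 0 := by
  rcases lt_or_gt_of_ne hz with h1 | h1
  · exact h1
  · rw [logPlus_of_im_pos h1, left_eq_add] at h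
    exact absurd h Complex.two_pi_I_ne_zero

/-- `1 / φ(z) - 1 / z` extends analytically to `0`. -/
theorem IsTangentToId.exists_one_div_sub {φ : ℂ → ℂ} (hφ : IsTangentToId φ) :
    ∃ m : ℂ → ℂ, AnalyticAt ℂ m 0 ∧ ∀ᶠ z in 𝓝 (0 : ℂ), z ≠ 0 → 1 / φ z - 1 / z = m z := by
  obtain ⟨u, hu, hu1, hφu⟩ := hφ.exists_eq_mul
  obtain ⟨ε, -, hε, -, hd, -⟩ := hu.exists_ball_differentiableOn_bounded
  have hv : AnalyticAt ℂ (dslope u 0) 0 :=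
    ((Complex.differentiableOn_dslope (Metric.ball_mem_nhds _ hε)).mpr hd).analyticAt
      (Metric.ball_mem_nhds _ hε)
  have hu0 : u 0 ≠ 0 := by rw [hu1]; exact one_ne_zero
  refine ⟨fun z => -dslope u 0 z / u z, hv.neg.div hu hu0, ?_⟩
  filter_upwards [hu.continuousAt.eventually_ne hu0] with z h1 hz
  have h2 := sub_smul_dslope u 0 z
  rw [sub_zero, smul_eq_mul, hu1] at h2
  rw [hφu]
  field_simp
  linear_combination h2

theorem exists_sector_forall_of_eventually {p : ℂ → Prop} (hp : ∀ᶠ z in 𝓝 (0 : ℂ), p z) (d : ℂ)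
    (θ : ℝ) : ∃ ρ : ℝ, 0 < ρ ∧ ∀ z ∈ sector d θ ρ, p z := by
  obtain ⟨ρ, hρ, h⟩ := Metric.eventually_nhds_iff_ball.mp hp
  exact ⟨ρ, hρ, fun z hz => h z (by simpa using hz.2.1)⟩

/-- Replacing `1 / φ z` by `1 / z` costs only an analytic germ. -/
theorem HasGevreyExpansion.add_one_div_comp {d : ℂ} (hd : ‖d‖ = 1) {φ Ψ : ℂ → ℂ}
    (hφ : IsTangentToId φ) (h : HasGevreyExpansion d (fun z => Ψ z + 1 / z)) :
    HasGevreyExpansion d (fun z => Ψ (φ z) + 1 / z) := by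
  obtain ⟨m, hm, he⟩ := hφ.exists_one_div_sub
  refine ((h.comp hd hφ).sub (HasGevreyExpansion.of_analyticAt d hm)).congr fun θ _ _ => ?_
  obtain ⟨ρ, hρ, hs⟩ := exists_sector_forall_of_eventually he d θ
  refine ⟨ρ, hρ, fun z hz => ?_⟩
  rw [← hs z hz hz.1]; ring

/-- Here `ℓ (φ z) = ℓ z + log (u z)`, so the correction `s + log u` is analytic. The constant `c`
allows one statement for both branches. -/
theorem HasGevreyExpansion.add_log_comp {d : ℂ} (hd : ‖d‖ = 1) {φ u H s ℓ : ℂ → ℂ} {c : ℂ}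
    (hℓ : ∀ z, ℓ z = Complex.log (z / d) + c)
    (hφ : IsTangentToId φ) (hu : AnalyticAt ℂ u 0) (hu1 : u 0 = 1) (hφu : ∀ z, φ z = z * u z)
    (hs : AnalyticAt ℂ s 0) (h : HasGevreyExpansion d (fun z => H z + ℓ z)) :
    HasGevreyExpansion d (fun z => (H (φ z) - s z) + ℓ z) := by
  have hm : AnalyticAt ℂ (fun z => s z + Complex.log (u z)) 0 :=
    hs.add (hu.clog (by rw [hu1]; exact Complex.one_mem_slitPlane))
  refine ((h.comp hd hφ).sub (HasGevreyExpansion.of_analyticAt d hm)).congr fun θ h0 hπ => ?_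
  obtain ⟨ρ, hρ, -, hsec⟩ := exists_sector_mul_mem hu.continuousAt hu1 hd hπ le_rfl one_pos
  refine ⟨ρ, hρ, fun z hz => ?_⟩
  have := (hsec z hz).2
  rw [← hφu] at this
  rw [hℓ, hℓ, this]; ring

/-- Composition with `φ` replaces `c` by `c ∘ φ`, and subtracting `s` removes the coboundary `s ∘ g
- s`. -/
theorem IsCohomologicalSolution.comp {f g φ c c' H s : ℂ → ℂ} {V W : Set ℂ}
    (hH : IsCohomologicalSolution f V c H) (hφ : DifferentiableOn ℂ φ W)
    (hφV : Set.MapsTo φ W V) (hs : DifferentiableOn ℂ s W)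
    (hconj : ∀ z ∈ W, φ (g z) = f (φ z))
    (hc : ∀ z ∈ W, g z ∈ W → c (φ z) - (s (g z) - s z) = c' z) :
    IsCohomologicalSolution g W c' (fun z => H (φ z) - s z) := by
  refine ⟨(hH.1.comp hφ hφV).sub hs, fun z hz hgz => ?_⟩
  have h1 := hH.2 (φ z) (hφV hz) (by rw [← hconj z hz]; exact hφV hgz)
  rw [← hconj z hz] at h1
  rw [← hc z hz hgz]
  linear_combination h1

/-! ### Invariance of the moments -/

theorem IsOneMoment.of_conjugatesBy {f g φ ψ r : ℂ → ℂ} {p : MomentPair} (hf : IsModelGerm f)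
    (hg : IsModelGerm g) (hr : AnalyticAt ℂ r 0) (hc : ConjugatesBy φ ψ f g)
    (hψ : ∀ᶠ z in 𝓝 (0 : ℂ), ψ z = z + r (f z) - r z) (h : IsOneMoment f p) :
    IsOneMoment g p := by
  obtain ⟨hφ, hφψ, hgc⟩ := hc
  obtain ⟨k, Vp, Vm, Ψ, Hp, Hm, hk, hVp, hVm, hΨ, hΨg, hHp, hHpg, hHm, hHmg, δ, hδ, hup, hdown⟩ := h
  obtain ⟨u, hu, hu1, hφu⟩ := hφ.exists_eq_mul
  have hft := hf.isTangentToId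
  have hgt := hg.isTangentToId
  have hkt := hk.isTangentToId hft
  have hψt := hφψ.isTangentToId hφ
  have hconj : ∀ᶠ z in 𝓝 (0 : ℂ), φ (g z) = f (φ z) := by
    filter_upwards [hgc, (hft.comp hφ).tendsto.eventually hφψ.2.2] with z h1 h2
    rw [h1, h2.2]
  set k' : ℂ → ℂ := fun z => ψ (k (φ z)) with hk'
  have hk't : IsTangentToId k' := hψt.comp (hkt.comp hφ)
  have hconj' : ∀ᶠ z in 𝓝 (0 : ℂ), φ (k' z) = k (φ z) := by
    filter_upwards [(hkt.comp hφ).tendsto.eventually hφψ.2.2] with z h2 using h2.2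
  have hgk : IsInverseGerm g k' := by
    refine ⟨hk't.1, hk't.2.1, ?_⟩
    filter_upwards [hconj, hconj', hk't.tendsto.eventually hgc, hφψ.2.2,
      hφ.tendsto.eventually hk.2.2] with z h1 h2 h3 h4 h5
    exact ⟨by simp only [hk', h1, h5.1, h4.1], by rw [h3, h2, h5.2, h4.1]⟩
  -- This is the formula for `φ⁻¹` evaluated at `φ z`, the only place where its special form enters.
  have hshift : ∀ᶠ z in 𝓝 (0 : ℂ), z = φ z + r (φ (g z)) - r (φ z) := by
    filter_upwards [hφ.tendsto.eventually hψ, hφψ.2.2, hconj] with z h1 h2 h3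
    rw [h3, ← h1, h2.1]
  have hra : ∀ᶠ z in 𝓝 (0 : ℂ), DifferentiableAt ℂ r (φ z) :=
    hφ.tendsto.eventually (hr.eventually_analyticAt.mono fun z hz => hz.differentiableAt)
  have hp := hconj.and (hshift.and hra)
  have n1 : ‖(-1 : ℂ)‖ = 1 := by simp
  have n2 : ‖(1 : ℂ)‖ = 1 := by simp
  have hgd := hg.isNearTranslation
  obtain ⟨Wp, hWp, hWpV, hWpp, hWpφ, hWpl⟩ :=
    hVp.exists_pullback n1 hu hu1 hφu hgt hgd hconj hp
  obtain ⟨Wm, hWm, hWmV, hWmp, hWmφ, hWml⟩ :=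
    hVm.exists_pullback n2 hu hu1 hφu hk't (hgd.inverse hgt hgk) hconj' hp
  set s : ℂ → ℂ := fun z => r (φ z) with hs
  have hsa : AnalyticAt ℂ s 0 := AnalyticAt.comp (by rw [hφ.2.1]; exact hr) hφ.1
  have hsd : ∀ {W : Set ℂ}, DifferentiableOn ℂ φ W → (∀ z ∈ W, DifferentiableAt ℂ r (φ z)) →
      DifferentiableOn ℂ s W := fun h1 h2 z hz => (h2 z hz).comp_differentiableWithinAt z (h1 z hz)
  -- The same `log (u z)` occurs for both branches, so it cancels in the difference `R₊ - R₋`.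
  have hmem : ∀ z ∈ Wp ∩ Wm, (φ z).im ≠ 0 ∧
      logPlus (φ z) = logPlus z + Complex.log (u z) ∧
      Complex.log (φ z) = Complex.log z + Complex.log (u z) := by
    intro z hz
    refine ⟨im_ne_zero_of_mem_slitPlane (hVm.subset_slit _ (hWmV hz.2))
      (hVp.subset_slit _ (hWpV hz.1)), ?_, ?_⟩
    · rw [logPlus_eq_log_div, logPlus_eq_log_div, hWpl z hz.1]; ring
    · simpa using hWml z hz.2
  refine ⟨k', Wp, Wm, fun z => Ψ (φ z), fun z => Hp (φ z) - s z, fun z => Hm (φ z) - s z, hgk,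
    hWp, hWm, ?_, hΨg.add_one_div_comp n1 hφ, ?_,
    hHpg.add_log_comp n1 logPlus_eq_log_div hφ hu hu1 hφu hsa, ?_,
    hHmg.add_log_comp n2 (c := 0) (fun z => by simp) hφ hu hu1 hφu hsa, δ, hδ, ?_, ?_⟩
  · have := hΨ.comp (g := g) (s := fun _ => 0) (c' := fun _ => 1) hWpφ hWpV
      (differentiableOn_const 0) (fun z hz => (hWpp z hz).1) (fun z _ _ => by simp)
    simpa using this
  · refine hHp.comp hWpφ hWpV (hsd hWpφ fun z hz => (hWpp z hz).2.2)
      (fun z hz => (hWpp z hz).1) fun z hz _ => ?_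
    linear_combination (hWpp z hz).2.1
  · refine hHm.comp hWmφ hWmV (hsd hWmφ fun z hz => (hWmp z hz).2.2)
      (fun z hz => (hWmp z hz).1) fun z hz _ => ?_
    linear_combination (hWmp z hz).2.1
  · intro z hz him hsmall
    obtain ⟨hne, hl1, hl2⟩ := hmem z hz
    rw [← hup (φ z) ⟨hWpV hz.1, hWmV hz.2⟩ ?_ hsmall, hl1, hl2]
    · ring
    · exact im_pos_of_logPlus_eq hne (by rw [hl1, hl2, logPlus_of_im_pos him])
  · intro z hz him hsmall
    obtain ⟨hne, hl1, hl2⟩ := hmem z hz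
    rw [← hdown (φ z) ⟨hWpV hz.1, hWmV hz.2⟩ ?_ hsmall, hl1, hl2]
    · ring
    · exact im_neg_of_logPlus_eq hne (by rw [hl1, hl2, logPlus_of_im_neg him]; ring)

theorem IsModelGerm.congr {f f' : ℂ → ℂ} (hf : IsModelGerm f) (h : f =ᶠ[𝓝 0] f') :
    IsModelGerm f' :=
  ⟨hf.1.congr h, hf.2.congr' (h.mono fun z hz => by simp only [hz]) EventuallyEq.rfl⟩

/-- Moments of a germ may be computed from any representative `f'`, so the conjugacy data are first
transferred from `f` to `f'`. -/
theorem oneMoment_subset_of_conjugatesBy {f g φ ψ r : ℂ → ℂ} (hf : IsModelGerm f)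
    (hg : IsModelGerm g) (hr : AnalyticAt ℂ r 0) (hc : ConjugatesBy φ ψ f g)
    (hψ : ∀ᶠ z in 𝓝 (0 : ℂ), ψ z = z + r (f z) - r z) :
    oneMoment (ModelGerm.mk f hf) ⊆ oneMoment (ModelGerm.mk g hg) := by
  rintro c ⟨f', p, hf', hp, rfl⟩
  have he : f =ᶠ[𝓝 0] f' := Germ.coe_eq.mp hf'
  refine ⟨g, p, rfl, hp.of_conjugatesBy (hf.congr he) hg hr ⟨hc.1, hc.2.1, ?_⟩ ?_, rfl⟩
  · filter_upwards [hc.2.2, hc.1.tendsto.eventually he] with z h1 h2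
    rw [h1, h2]
  · filter_upwards [hψ, he] with z h1 h2
    rw [h1, h2]

/-- Conjugacies whose inverse is `Id + r ∘ f - r` preserve the `1`-moments. -/
theorem oneConjugate_of_conjugatesBy {f g φ ψ r : ℂ → ℂ} (hf : IsModelGerm f)
    (hg : IsModelGerm g) (hr : AnalyticAt ℂ r 0) (hc : ConjugatesBy φ ψ f g)
    (hψ : ∀ᶠ z in 𝓝 (0 : ℂ), ψ z = z + r (f z) - r z) :
    OneConjugate (ModelGerm.mk f hf) (ModelGerm.mk g hg) := by
  refine (oneMoment_subset_of_conjugatesBy hf hg hr hc hψ).antisymm ?_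
  obtain ⟨hφ, hφψ, hgc⟩ := hc
  have hψt := hφψ.isTangentToId hφ
  have hft := hf.isTangentToId
  -- The reverse conjugacy has the same form, with `r' = -r ∘ φ`.
  refine oneMoment_subset_of_conjugatesBy (φ := ψ) (ψ := φ) (r := fun z => -r (φ z)) hg hf
    (AnalyticAt.comp (by rw [hφ.2.1]; exact hr) hφ.1).neg ⟨hψt, hφψ.symm hφ, ?_⟩ ?_
  · filter_upwards [hψt.tendsto.eventually hgc, hφψ.2.2, hft.tendsto.eventually hφψ.2.2]
      with z h1 h2 h3
    rw [h1, h2.2, h3.2]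
  · filter_upwards [hgc, (hft.comp hφ).tendsto.eventually hφψ.2.2, hφ.tendsto.eventually hψ,
      hφψ.2.2] with z h1 h2 h3 h4
    rw [h4.1] at h3
    rw [h1, h2.2]
    linear_combination -h3

/-! ### A nontrivial conjugacy preserving the moments -/

theorem IsTangentToId.exists_isInverseGerm {ψ : ℂ → ℂ} (hψ : IsTangentToId ψ) :
    ∃ φ : ℂ → ℂ, IsInverseGerm ψ φ := by
  obtain ⟨ha, h0, h1⟩ := hψ
  have hne : deriv ψ 0 ≠ 0 := by rw [h1]; exact one_ne_zero
  have hleft := (ha.hasStrictDerivAt.hasStrictFDerivAt_equiv hne).eventually_left_inverse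
  have hright := (ha.hasStrictDerivAt.hasStrictFDerivAt_equiv hne).eventually_right_inverse
  have himg := (ha.hasStrictDerivAt.hasStrictFDerivAt_equiv hne).localInverse_apply_image
  have han := ha.analyticAt_localInverse hne
  rw [h0] at hright himg han
  exact ⟨_, han, himg, hleft.and hright⟩

/-- The change of variable `z + f(z)² - z²` does not commute with `f`: the commutator starts with
`2 z⁴`. -/
theorem IsModelGerm.exists_commutator {f : ℂ → ℂ} (hf : IsModelGerm f) :
    ∃ E : ℂ → ℂ, ContinuousAt E 0 ∧ E 0 = 2 ∧ ∀ᶠ z in 𝓝 (0 : ℂ),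
      f z + f (f z) ^ 2 - f z ^ 2
        = f (z + f z ^ 2 - z ^ 2) + z ^ 4 * E z := by
  obtain ⟨h, hh, he⟩ := hf.exists_remainder
  have hft := hf.isTangentToId.tendsto
  have hf0 := hf.map_zero
  have hfc : ContinuousAt f 0 := hf.1.continuousAt
  set ψ : ℂ → ℂ := fun z => z + f z ^ 2 - z ^ 2 with hψ
  have hψc : ContinuousAt ψ 0 := by fun_prop
  have hψ0 : ψ 0 = 0 := by simp [hψ, hf0]
  have hψt : Tendsto ψ (𝓝 0) (𝓝 0) := by simpa only [hψ0] using hψc.tendsto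
  have hhc : ContinuousAt h 0 := hh.continuousAt
  have hhψ : ContinuousAt h (ψ 0) := by rwa [hψ0]
  set t : ℂ → ℂ := fun z => 1 + z + z ^ 2 * h z with ht
  set v : ℂ → ℂ := fun z => 1 + z * t z with hv
  set n : ℂ → ℂ := fun z =>
    1 + h z * (2 + z) + z ^ 2 * h z * (1 + z * h z) + (1 + z) * (1 + z * h z) with hn
  set m : ℂ → ℂ := fun z => 2 + 3 * z + z ^ 2 * n z with hm
  set q : ℂ → ℂ := fun z => 1 + z ^ 2 * m z with hq
  have hfv : ∀ᶠ z in 𝓝 (0 : ℂ), f z = z * v z := by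
    filter_upwards [he] with z hz
    rw [hz]; simp only [hv, ht]; ring
  have hψm : ∀ᶠ z in 𝓝 (0 : ℂ), ψ z = z + z ^ 3 * m z := by
    filter_upwards [he] with z hz
    simp only [hψ, hz, hm, hn]; ring
  have htc : ContinuousAt t 0 := by fun_prop
  have hvc : ContinuousAt v 0 := by fun_prop
  have hnc : ContinuousAt n 0 := by fun_prop
  have hmc : ContinuousAt m 0 := by fun_prop
  have hqc : ContinuousAt q 0 := by fun_prop
  have hnf : ContinuousAt n (f 0) := by rwa [hf0]
  have hmf : ContinuousAt m (f 0) := by rwa [hf0]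
  -- The terms of `E` come in order from `z² - ψ²`, `z³ - ψ³`, `z⁴ h - ψ⁴ h(ψ)` and `f³ m(f) - z³
  -- m`, the last split through `v³ - 1` and `m(f) - m`. At `0` only `-4` and `6` survive.
  refine ⟨fun z => -m z * (q z + 1) - z * m z * (q z ^ 2 + q z + 1) + h z - q z ^ 4 * h (ψ z)
    + t z * (3 + 3 * z * t z + z ^ 2 * t z ^ 2) * m (f z)
    + z * (3 * t z + v z ^ 2 * n (f z) - n z), by fun_prop, ?_, ?_⟩
  · simp only [hq, hm, ht, hf0, hψ0]; ring
  · filter_upwards [he, hfv, hψm, hft.eventually hψm, hψt.eventually he]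
      with z h1 h2 h3 h4 h5
    have h6 : f z + f (f z) ^ 2 - f z ^ 2 = ψ (f z) := rfl
    have h7 : m (f z) = 2 + 3 * (z * v z) + (z * v z) ^ 2 * n (f z) := by rw [← h2]
    have h8 : ψ z = z * q z := by rw [h3]; simp only [hq]; ring
    have h9 : f z = z + z ^ 2 + z ^ 3 + z ^ 4 * h z := h1
    have h10 : v z = 1 + z * t z := rfl
    have h11 : q z = 1 + z ^ 2 * m z := rfl
    have h12 : m z = 2 + 3 * z + z ^ 2 * n z := rfl
    rw [h6, h4, h5]
    -- With function values replaced by independent variables, a polynomial identity remains.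
    generalize hX : m (f z) = X at *
    generalize h (ψ z) = Y at *
    generalize n (f z) = Z at *
    rw [h8]
    have h13 : f z ^ 3 * X = z ^ 3 * v z ^ 3 * X := by rw [h2]; ring
    rw [h13, h9]
    generalize v z = V at *
    generalize t z = T at *
    generalize q z = Q at *
    generalize m z = M at *
    generalize n z = N at *
    generalize h z = H at *
    clear * - h7 h10 h11 h12
    subst h11 h10
    have h14 : X - M = 3 * z ^ 2 * T + z ^ 2 * ((1 + z * T) ^ 2 * Z - N) := by
      rw [h7, h12]; ring
    linear_combination z ^ 3 * h14

/-- With `r = z²` one gets `g = f + O(z⁴)`, so `g` stays prenormalized. Equality `g = f` would make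
`ψ` commute with `f`, against the nonzero leading coefficient of the commutator. -/
theorem IsModelGerm.exists_conjugate_ne {f : ℂ → ℂ} (hf : IsModelGerm f) :
    ∃ g φ ψ r : ℂ → ℂ, IsModelGerm g ∧ AnalyticAt ℂ r 0 ∧ ConjugatesBy φ ψ f g ∧
      (∀ᶠ z in 𝓝 (0 : ℂ), ψ z = z + r (f z) - r z) ∧ ¬ f =ᶠ[𝓝 0] g := by
  obtain ⟨E, hE, hE0, hcomm⟩ := hf.exists_commutator
  obtain ⟨h, hh, he⟩ := hf.exists_remainder
  have hft := hf.isTangentToId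
  have hfa := hf.1
  set ψ : ℂ → ℂ := fun z => z + f z ^ 2 - z ^ 2 with hψ
  have hψt : IsTangentToId ψ := by
    refine ⟨by fun_prop, by simp [hψ, hft.2.1], ?_⟩
    have hd := ((hasDerivAt_id (0 : ℂ)).add (hfa.differentiableAt.hasDerivAt.pow 2)).sub
      (hasDerivAt_pow 2 (0 : ℂ))
    exact hd.deriv.trans (by simp [hft.2.1])
  obtain ⟨φ, hφ⟩ := hψt.exists_isInverseGerm
  have hφt := hφ.isTangentToId hψt
  have hφψ := hφ.symm hψt
  set g : ℂ → ℂ := fun z => ψ (f (φ z)) with hg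
  have hgt : IsTangentToId g := hψt.comp (hft.comp hφt)
  refine ⟨g, φ, ψ, fun z => z ^ 2, ⟨hgt.1, ?_⟩, by fun_prop,
    ⟨hφt, hφψ, Eventually.of_forall fun z => rfl⟩, Eventually.of_forall fun z => rfl, ?_⟩
  · obtain ⟨w, hw, hw1, hφw⟩ := hφt.exists_eq_mul
    have hEφ : ContinuousAt E (φ 0) := by rwa [hφt.2.1]
    have hφc := hφt.1.continuousAt
    have hwc := hw.continuousAt
    have hhc := hh.continuousAt
    have hc : ContinuousAt (fun z => z * (w z ^ 4 * E (φ z) + h z)) 0 := by fun_prop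
    have hlim : (fun z => z * (w z ^ 4 * E (φ z) + h z)) =o[𝓝 0] (fun _ : ℂ => (1 : ℂ)) := by
      rw [Asymptotics.isLittleO_one_iff]
      simpa using hc.tendsto
    have h3 := (Asymptotics.isBigO_refl (fun z : ℂ => z ^ 3) (𝓝 0)).mul_isLittleO hlim
    refine h3.congr' ?_ (Eventually.of_forall fun z => mul_one _)
    filter_upwards [hφt.tendsto.eventually hcomm, hφψ.2.2, he] with z h1 h2 h4
    have h5 : g z = f (ψ (φ z)) + φ z ^ 4 * E (φ z) := h1
    rw [h5, h2.1, h4, hφw z]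
    ring
  · intro hfg
    have e1 : ∀ᶠ z in 𝓝 (0 : ℂ), z ^ 4 * E z = 0 := by
      filter_upwards [hcomm, hψt.tendsto.eventually hfg, hφψ.2.2] with z h1 h2 h3
      have h4 : ψ (f z) = f (ψ z) + z ^ 4 * E z := h1
      have h5 : f (ψ z) = ψ (f (φ (ψ z))) := h2
      rw [h5, h3.2] at h4
      linear_combination -h4
    have e2 := hE.eventually_ne (by rw [hE0]; exact two_ne_zero)
    obtain ⟨z, ⟨h1, h2⟩, hz⟩ :=
      (((e1.and e2).filter_mono (nhdsWithin_le_nhds (s := {(0 : ℂ)}ᶜ))).and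
        self_mem_nhdsWithin).exists
    exact mul_ne_zero (pow_ne_zero 4 hz) h2 h1

theorem mem_analyticClass_self (F : ModelGerm) : F ∈ analyticClass F := by
  obtain ⟨f, hf, hF⟩ := F.2
  have hid : IsTangentToId (fun z => z) := ⟨analyticAt_id, rfl, deriv_id 0⟩
  exact ⟨f, f, fun z => z, fun z => z, hF, hF,
    hid, ⟨analyticAt_id, rfl, Eventually.of_forall fun _ => ⟨rfl, rfl⟩⟩,
    Eventually.of_forall fun _ => rfl⟩

theorem mainTheorem7 :
    (∀ (f g φ ψ r : ℂ → ℂ) (hf : IsModelGerm f) (hg : IsModelGerm g),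
      AnalyticAt ℂ r 0 →
      ConjugatesBy φ ψ f g →
      (∀ᶠ z in 𝓝 (0 : ℂ), ψ z = z + r (f z) - r z) →
      OneConjugate (ModelGerm.mk f hf) (ModelGerm.mk g hg)) ∧
    (∀ F : ModelGerm, ¬ Set.InjOn Phi (analyticClass F)) := by
  refine ⟨fun f g φ ψ r hf hg hr hc hψ => oneConjugate_of_conjugatesBy hf hg hr hc hψ,
    fun F hinj => ?_⟩
  have hself := mem_analyticClass_self F
  obtain ⟨F, f, hf, rfl⟩ := F
  obtain ⟨g, φ, ψ, r, hg, hr, hc, hψ, hne⟩ := hf.exists_conjugate_ne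
  have hconj := oneConjugate_of_conjugatesBy hf hg hr hc hψ
  have hG : ModelGerm.mk g hg ∈ analyticClass (ModelGerm.mk f hf) :=
    ⟨f, g, φ, ψ, rfl, rfl, hc⟩
  have hPhi : Phi (ModelGerm.mk f hf) = Phi (ModelGerm.mk g hg) := by
    have h1 : oneMoment (ModelGerm.mk f hf) = oneMoment (ModelGerm.mk g hg) := hconj
    ext G
    change oneMoment G = _ ↔ oneMoment G = _
    rw [h1]
  have heq := hinj hself hG hPhi
  exact hne (Germ.coe_eq.mp (congrArg Subtype.val heq))
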